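/- Let $K$ be a field. For a $K$-coalgebra $C$ let $\mathbf M^C$ be the category of right $C$-comodules. A coalgebra morphism $\alpha:C\to D$ induces the corestriction functor $\alpha^*:\mathbf M^C\to\mathbf M^D$, $(M,\rho)\mapsto(M,(\mathrm{id}\otimes\alpha)\rho)$, and its right adjoint, the coinduction functor $\alpha_*:\mathbf M^D\to\mathbf M^C$, $N\mapsto N\square_D C$ (cotensor product). The morphism $\alpha$ is called left coflat if $\alpha_*$ is exact, and $C$ is called (right) semiperfect if $\mathbf M^C$ has enough projectives. Let $\mathscr X$ be a partially ordered set (small, viewed as a category), and let $\mathcal C:\mathscr X\to Coalg$ be a functor to the category of $K$-coalgebras such that $\mathcal C_x$ is semiperfect for each $x\in\mathscr X$ and $\mathcal C_\alpha:\mathcal C_x\to\mathcal C_y$ is left coflat for each morphism $\alpha:x\to y$ in $\mathscr X$; write $\alpha^*,\alpha_*$ for the functors induced by $\mathcal C_\alpha$. A (right) cis-comodule $\mathcal M$ over $\mathcal C$ consists of a right $\mathcal C_x$-comodule $\mathcal M_x$ for each $x$ and a morphism $\mathcal M^\alpha:\alpha^*\mathcal M_x\to\mathcal M_y$ of right $\mathcal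 C_y$-comodules for each $\alpha:x\to y$ (equivalently, by adjunction, a morphism $\mathcal M_\alpha:\mathcal M_x\to\alpha_*\mathcal M_y=\mathcal M_y\square_{\mathcal C_y}\mathcal C_x$ of right $\mathcal C_x$-comodules), with $\mathcal M^{\mathrm{id}_x}=\mathrm{id}$ and $\mathcal M^{\beta\alpha}=\mathcal M^\beta\circ\beta^*(\mathcal M^\alpha)$ for composable $\alpha,\beta$. A morphism $\eta:\mathcal M\to\mathcal N$ of cis-comodules is a family of comodule morphisms $\eta_x:\mathcal M_x\to\mathcal N_x$ with $\eta_y\circ\mathcal M^\alpha=\mathcal N^\alpha\circ\alpha^*(\eta_x)$ for each $\alpha:x\to y$. A cis-comodule $\mathcal M$ is cartesian if $\mathcal M_\alpha:\mathcal M_x\to\alpha_*\mathcal M_y$ is an isomorphism for each $\alpha:x\to y$. Let $Com^{cs}_c\text{-}\mathcal C$ be the full subcategory of cartesian cis-comodules in the category of cis-comodules over $\mathcal C$. Then $Com^{cs}_c\text{-}\mathcal C$ is a Grothendieck category, that is, it is an abelian category with small colimits and a generator, in which filtered colimits are exact. -/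

import Mathlib

open CategoryTheory TensorProduct

universe u

/-! ## Right comodules over a coalgebra -/

/-- A right comodule `M` over a `K`-coalgebra `C`: a `K`-vector space with a coassociative and
counital coaction `ρ : M → M ⊗ C`. -/
structure RightComod (K : Type u) [Field K] (C : Type u) [AddCommGroup C] [Module K C]
    [Coalgebra K C] where
  carrier : Type u
  [addCommGroup : AddCommGroup carrier]
  [module : Module K carrier]
  /-- The coaction `ρ : M → M ⊗ C`. -/
  coact : carrier →ₗ[K] carrier ⊗[K] C
  coassoc : TensorProduct.assoc K carrier C C ∘ₗ coact.rTensor C ∘ₗ coact =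
    (Coalgebra.comul (R := K) (A := C)).lTensor carrier ∘ₗ coact
  counit : TensorProduct.rid K carrier ∘ₗ
    (Coalgebra.counit (R := K) (A := C)).lTensor carrier ∘ₗ coact = LinearMap.id

attribute [instance] RightComod.addCommGroup RightComod.module

namespace RightComod

variable {K : Type u} [Field K]
variable {C : Type u} [AddCommGroup C] [Module K C] [Coalgebra K C]
variable {D : Type u} [AddCommGroup D] [Module K D] [Coalgebra K D]

instance : CoeSort (RightComod K C) (Type u) := ⟨carrier⟩

/-- Morphisms of right `C`-comodules: linear maps commuting with the coactions. -/
@[ext]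
structure Hom (M N : RightComod K C) where
  toLin : M →ₗ[K] N
  comm : N.coact ∘ₗ toLin = toLin.rTensor C ∘ₗ M.coact

/-- The category `𝐌^C` of right `C`-comodules. -/
instance : Category (RightComod K C) where
  Hom := Hom
  id M := ⟨LinearMap.id, by simp⟩
  comp f g := ⟨g.toLin ∘ₗ f.toLin, by
    rw [← LinearMap.comp_assoc, g.comm, LinearMap.comp_assoc, f.comm, LinearMap.rTensor_comp,
      LinearMap.comp_assoc]⟩

@[ext]
theorem hom_ext {M N : RightComod K C} {f g : M ⟶ N} (h : f.toLin = g.toLin) : f = g :=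
  Hom.ext h

@[simp]
theorem id_toLin (M : RightComod K C) : Hom.toLin (𝟙 M) = LinearMap.id := rfl

@[simp]
theorem comp_toLin {M N P : RightComod K C} (f : M ⟶ N) (g : N ⟶ P) :
    (f ≫ g).toLin = g.toLin ∘ₗ f.toLin := rfl

/-- The corestriction `α^* : 𝐌^C → 𝐌^D` on objects: `(M, ρ) ↦ (M, (id ⊗ α) ∘ ρ)`. -/
@[reducible]
def corestrictObj (α : C →ₗc[K] D) (M : RightComod K C) : RightComod K D where
  carrier := M.carrier
  coact := α.toLinearMap.lTensor M.carrier ∘ₗ M.coact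
  coassoc := by
    have h1 : (TensorProduct.assoc K M.carrier D D).toLinearMap ∘ₗ
        (α.toLinearMap.lTensor M.carrier ∘ₗ M.coact).rTensor D ∘ₗ
          α.toLinearMap.lTensor M.carrier =
        (TensorProduct.map α.toLinearMap α.toLinearMap).lTensor M.carrier ∘ₗ
          (TensorProduct.assoc K M.carrier C C).toLinearMap ∘ₗ M.coact.rTensor C := by
      refine TensorProduct.ext' fun m c => ?_
      simp only [LinearMap.comp_apply, LinearMap.lTensor_tmul, LinearMap.rTensor_tmul]
      induction M.coact m using TensorProduct.induction_on with
      | zero => simp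
      | tmul m' c' => simp
      | add a b ha hb => simp only [map_add, TensorProduct.add_tmul, ha, hb]
    have h2 := congrArg ((TensorProduct.map α.toLinearMap α.toLinearMap).lTensor M.carrier ∘ₗ ·)
      M.coassoc
    have h3 := congrArg (fun f => LinearMap.comp f M.coact) h1
    simp only [LinearMap.comp_assoc] at h2 h3 ⊢
    rw [h3, h2, ← LinearMap.comp_assoc, ← LinearMap.lTensor_comp, ← LinearMap.comp_assoc,
      ← LinearMap.lTensor_comp]
    congr 2
    exact α.map_comp_comul
  counit := by
    have h : (Coalgebra.counit (R := K) (A := D)).lTensor M.carrier ∘ₗ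
        α.toLinearMap.lTensor M.carrier = (Coalgebra.counit (R := K) (A := C)).lTensor M.carrier := by
      rw [← LinearMap.lTensor_comp]
      exact congrArg (LinearMap.lTensor M.carrier) α.counit_comp
    rw [← LinearMap.comp_assoc _ (LinearMap.lTensor _ _) (LinearMap.lTensor _ _), h]
    exact M.counit

/-- The corestriction functor `α^* : 𝐌^C ⥤ 𝐌^D`. -/
def corestrict (α : C →ₗc[K] D) : RightComod K C ⥤ RightComod K D where
  obj M := corestrictObj α M
  map {M N} f := ⟨f.toLin, by
    have : (α.toLinearMap.lTensor N.carrier) ∘ₗ f.toLin.rTensor C =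
      f.toLin.rTensor D ∘ₗ α.toLinearMap.lTensor M.carrier := by
      rw [LinearMap.lTensor_comp_rTensor, LinearMap.rTensor_comp_lTensor]
    change (α.toLinearMap.lTensor N.carrier ∘ₗ N.coact) ∘ₗ f.toLin =
      f.toLin.rTensor D ∘ₗ α.toLinearMap.lTensor M.carrier ∘ₗ M.coact
    rw [LinearMap.comp_assoc, f.comm, ← LinearMap.comp_assoc, this, LinearMap.comp_assoc]⟩

/-! ## Coinduction: the cotensor product `M □_D C` -/

/-- The left `D`-coaction `(α ⊗ id) ∘ Δ : C → D ⊗ C` on `C` induced by `α : C → D`. -/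
def leftCoaction (α : C →ₗc[K] D) : C →ₗ[K] D ⊗[K] C :=
  α.toLinearMap.rTensor C ∘ₗ Coalgebra.comul

/-- The cotensor product `M □_D C`, the equalizer of
`ρ^M ⊗ id, id ⊗ ^Cρ : M ⊗ C → M ⊗ D ⊗ C`, as a subspace of `M ⊗ C`. -/
def cotensor (α : C →ₗc[K] D) (M : RightComod K D) : Submodule K (M ⊗[K] C) :=
  LinearMap.eqLocus
    ((TensorProduct.assoc K M D C).toLinearMap ∘ₗ M.coact.rTensor C)
    ((leftCoaction α).lTensor M)

/-- `id ⊗ Δ : M ⊗ C → (M ⊗ C) ⊗ C`. -/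
def cofreeCoact (K : Type u) [Field K] (C : Type u) [AddCommGroup C] [Module K C]
    [Coalgebra K C] (V : Type u) [AddCommGroup V] [Module K V] :
    V ⊗[K] C →ₗ[K] (V ⊗[K] C) ⊗[K] C :=
  (TensorProduct.assoc K V C C).symm.toLinearMap ∘ₗ
    (Coalgebra.comul (R := K) (A := C)).lTensor V

theorem cofreeCoact_naturality {V W : Type u} [AddCommGroup V] [Module K V] [AddCommGroup W]
    [Module K W] (f : V →ₗ[K] W) :
    (f.rTensor C).rTensor C ∘ₗ cofreeCoact K C V = cofreeCoact K C W ∘ₗ f.rTensor C := by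
  refine TensorProduct.ext' fun v c => ?_
  simp only [cofreeCoact, LinearMap.comp_apply, LinearMap.lTensor_tmul, LinearMap.rTensor_tmul]
  induction Coalgebra.comul (R := K) c using TensorProduct.induction_on with
  | zero => simp
  | tmul a b => simp
  | add a b ha hb => simp only [TensorProduct.tmul_add, map_add, ha, hb]

theorem cofreeCoact_coassoc (V : Type u) [AddCommGroup V] [Module K V] :
    (TensorProduct.assoc K (V ⊗[K] C) C C).toLinearMap ∘ₗ
        (cofreeCoact K C V).rTensor C ∘ₗ cofreeCoact K C V =
      (Coalgebra.comul (R := K) (A := C)).lTensor (V ⊗[K] C) ∘ₗ cofreeCoact K C V := by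
  refine TensorProduct.ext' fun v c => ?_
  have h1 : ∀ t : C ⊗[K] C,
      TensorProduct.assoc K (V ⊗[K] C) C C
        ((cofreeCoact K C V).rTensor C ((TensorProduct.assoc K V C C).symm (v ⊗ₜ t))) =
      (TensorProduct.assoc K V C (C ⊗[K] C)).symm (v ⊗ₜ
        (TensorProduct.assoc K C C C ((Coalgebra.comul (R := K) (A := C)).rTensor C t))) := by
    intro t
    induction t using TensorProduct.induction_on with
    | zero => simp
    | tmul a b =>
      simp only [cofreeCoact, TensorProduct.assoc_symm_tmul, LinearMap.rTensor_tmul,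
        LinearMap.comp_apply, LinearMap.lTensor_tmul]
      induction Coalgebra.comul (R := K) a using TensorProduct.induction_on with
      | zero => simp
      | tmul x y => simp
      | add x y hx hy =>
        simp only [TensorProduct.tmul_add, TensorProduct.add_tmul, map_add, hx, hy]
    | add a b ha hb => simp only [TensorProduct.tmul_add, map_add, ha, hb]
  have h2 : ∀ t : C ⊗[K] C,
      (Coalgebra.comul (R := K) (A := C)).lTensor (V ⊗[K] C)
        ((TensorProduct.assoc K V C C).symm (v ⊗ₜ t)) =
      (TensorProduct.assoc K V C (C ⊗[K] C)).symm (v ⊗ₜ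
        ((Coalgebra.comul (R := K) (A := C)).lTensor C t)) := by
    intro t
    induction t using TensorProduct.induction_on with
    | zero => simp
    | tmul a b => simp
    | add a b ha hb => simp only [TensorProduct.tmul_add, map_add, ha, hb]
  have e : cofreeCoact K C V (v ⊗ₜ c) =
    (TensorProduct.assoc K V C C).symm (v ⊗ₜ Coalgebra.comul (R := K) c) := rfl
  simp only [LinearMap.comp_apply, LinearEquiv.coe_coe, e, h1, h2, Coalgebra.coassoc_apply]

theorem cofreeCoact_counit (V : Type u) [AddCommGroup V] [Module K V] :
    (TensorProduct.rid K (V ⊗[K] C)).toLinearMap ∘ₗ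
      (Coalgebra.counit (R := K) (A := C)).lTensor (V ⊗[K] C) ∘ₗ cofreeCoact K C V =
      LinearMap.id := by
  refine TensorProduct.ext' fun v c => ?_
  have h2 : ∀ t : C ⊗[K] C,
      TensorProduct.rid K (V ⊗[K] C) ((Coalgebra.counit (R := K) (A := C)).lTensor (V ⊗[K] C)
        ((TensorProduct.assoc K V C C).symm (v ⊗ₜ t))) =
      v ⊗ₜ (TensorProduct.rid K C ((Coalgebra.counit (R := K) (A := C)).lTensor C t)) := by
    intro t
    induction t using TensorProduct.induction_on with
    | zero => simp
    | tmul a b => simp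
    | add a b ha hb => simp only [TensorProduct.tmul_add, map_add, ha, hb]
  have e : cofreeCoact K C V (v ⊗ₜ c) =
    (TensorProduct.assoc K V C C).symm (v ⊗ₜ Coalgebra.comul (R := K) c) := rfl
  simp only [LinearMap.comp_apply, LinearEquiv.coe_coe, e, h2, Coalgebra.lTensor_counit_comul]
  simp

theorem mem_cotensor {α : C →ₗc[K] D} {M : RightComod K D} {w : M ⊗[K] C} :
    w ∈ cotensor α M ↔
      TensorProduct.assoc K M D C (M.coact.rTensor C w) = (leftCoaction α).lTensor M w :=
  Iff.rfl

theorem cofreeCoact_mem (α : C →ₗc[K] D) (M : RightComod K D) (w : cotensor α M) :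
    cofreeCoact K C M w ∈ LinearMap.range ((cotensor α M).subtype.rTensor C) := by
  set f₁ := (TensorProduct.assoc K M D C).toLinearMap ∘ₗ M.coact.rTensor C with hf₁
  set f₂ := (leftCoaction α).lTensor M with hf₂
  -- `id ⊗ id ⊗ Δ`
  let ψ : M ⊗[K] (D ⊗[K] C) →ₗ[K] (M ⊗[K] (D ⊗[K] C)) ⊗[K] C :=
    (TensorProduct.assoc K M (D ⊗[K] C) C).symm.toLinearMap ∘ₗ
      ((TensorProduct.assoc K D C C).symm.toLinearMap ∘ₗ
        (Coalgebra.comul (R := K) (A := C)).lTensor D).lTensor M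
  let G : (M ⊗[K] D) ⊗[K] (C ⊗[K] C) →ₗ[K] (M ⊗[K] (D ⊗[K] C)) ⊗[K] C :=
    (TensorProduct.assoc K M (D ⊗[K] C) C).symm.toLinearMap ∘ₗ
      (TensorProduct.assoc K D C C).symm.toLinearMap.lTensor M ∘ₗ
        (TensorProduct.assoc K M D (C ⊗[K] C)).toLinearMap
  have h₁ : f₁.rTensor C ∘ₗ cofreeCoact K C M = ψ ∘ₗ f₁ := by
    refine TensorProduct.ext' fun m c => ?_
    have a : ∀ t : C ⊗[K] C, f₁.rTensor C ((TensorProduct.assoc K M C C).symm (m ⊗ₜ t)) =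
        G (M.coact m ⊗ₜ t) := by
      intro t
      induction t using TensorProduct.induction_on with
      | zero => simp
      | tmul x y =>
        simp only [hf₁, G, LinearMap.comp_apply, LinearMap.rTensor_tmul, LinearEquiv.coe_coe,
          TensorProduct.assoc_symm_tmul]
        induction M.coact m using TensorProduct.induction_on with
        | zero => simp
        | tmul n d => simp
        | add p q hp hq => simp only [TensorProduct.add_tmul, map_add, hp, hq]
      | add p q hp hq => simp only [TensorProduct.tmul_add, map_add, hp, hq]
    have b : ∀ n : M ⊗[K] D, ψ (TensorProduct.assoc K M D C (n ⊗ₜ c)) =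
        G (n ⊗ₜ Coalgebra.comul (R := K) c) := by
      intro n
      induction n using TensorProduct.induction_on with
      | zero => simp
      | tmul n d => simp [ψ, G]
      | add p q hp hq => simp only [TensorProduct.add_tmul, map_add, hp, hq]
    exact (a (Coalgebra.comul (R := K) c)).trans (b (M.coact m)).symm
  have h₂ : f₂.rTensor C ∘ₗ cofreeCoact K C M = ψ ∘ₗ f₂ := by
    refine TensorProduct.ext' fun m c => ?_
    have a : ∀ t : C ⊗[K] C, f₂.rTensor C ((TensorProduct.assoc K M C C).symm (m ⊗ₜ t)) =
        (TensorProduct.assoc K M (D ⊗[K] C) C).symm (m ⊗ₜ (leftCoaction α).rTensor C t) := by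
      intro t
      induction t using TensorProduct.induction_on with
      | zero => simp
      | tmul x y => simp [hf₂]
      | add p q hp hq => simp only [TensorProduct.tmul_add, map_add, hp, hq]
    have b : ∀ t : C ⊗[K] C,
        (TensorProduct.assoc K D C C).symm
          ((Coalgebra.comul (R := K) (A := C)).lTensor D (α.toLinearMap.rTensor C t)) =
        (α.toLinearMap.rTensor C).rTensor C ((TensorProduct.assoc K C C C).symm
          ((Coalgebra.comul (R := K) (A := C)).lTensor C t)) := by
      intro t
      induction t using TensorProduct.induction_on with
      | zero => simp
      | tmul x y =>
        simp only [LinearMap.rTensor_tmul, LinearMap.lTensor_tmul]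
        induction Coalgebra.comul (R := K) y using TensorProduct.induction_on with
        | zero => simp
        | tmul x y => simp
        | add p q hp hq => simp only [TensorProduct.tmul_add, map_add, hp, hq]
      | add p q hp hq => simp only [map_add, hp, hq]
    have c' : (leftCoaction α).rTensor C (Coalgebra.comul (R := K) c) =
        (TensorProduct.assoc K D C C).symm
          ((Coalgebra.comul (R := K) (A := C)).lTensor D (leftCoaction α c)) := by
      rw [leftCoaction, LinearMap.comp_apply, b, Coalgebra.coassoc_symm_apply,
        LinearMap.rTensor_comp, LinearMap.comp_apply]
    have := a (Coalgebra.comul (R := K) c)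
    rw [c'] at this
    exact this
  have hex : Function.Exact (cotensor α M).subtype (f₁ - f₂) := by
    intro x
    rw [Submodule.coe_subtype, Subtype.range_coe_subtype, LinearMap.sub_apply, sub_eq_zero]
    exact Iff.rfl
  have hex' := Module.Flat.rTensor_exact C hex
  refine (hex' _).1 ?_
  rw [LinearMap.rTensor_sub, LinearMap.sub_apply, sub_eq_zero]
  have e₁ := LinearMap.congr_fun h₁ (w : M ⊗[K] C)
  have e₂ := LinearMap.congr_fun h₂ (w : M ⊗[K] C)
  rw [LinearMap.comp_apply, LinearMap.comp_apply] at e₁ e₂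
  rw [e₁, e₂]
  exact congrArg ψ w.2

theorem cotensor_rTensor_injective (α : C →ₗc[K] D) (M : RightComod K D) :
    Function.Injective ((cotensor α M).subtype.rTensor C) :=
  Module.Flat.rTensor_preserves_injective_linearMap _ (Submodule.subtype_injective _)

/-- The right `C`-coaction on `M □_D C`, the restriction of `id ⊗ Δ`. -/
noncomputable def cotensorCoact (α : C →ₗc[K] D) (M : RightComod K D) :
    cotensor α M →ₗ[K] cotensor α M ⊗[K] C :=
  (LinearEquiv.ofInjective _ (cotensor_rTensor_injective α M)).symm.toLinearMap ∘ₗ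
    (cofreeCoact K C M ∘ₗ (cotensor α M).subtype).codRestrict _ (cofreeCoact_mem α M)

theorem subtype_comp_cotensorCoact (α : C →ₗc[K] D) (M : RightComod K D) :
    (cotensor α M).subtype.rTensor C ∘ₗ cotensorCoact α M =
      cofreeCoact K C M ∘ₗ (cotensor α M).subtype := by
  refine LinearMap.ext fun w => ?_
  have := LinearEquiv.apply_symm_apply
    (LinearEquiv.ofInjective _ (cotensor_rTensor_injective α M))
    ((cofreeCoact K C M ∘ₗ (cotensor α M).subtype).codRestrict _ (cofreeCoact_mem α M) w)
  exact congrArg Subtype.val this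

/-- The coinduction `α_* : 𝐌^D → 𝐌^C`, `M ↦ M □_D C`, on objects. -/
@[reducible]
noncomputable def coinductObj (α : C →ₗc[K] D) (M : RightComod K D) : RightComod K C where
  carrier := cotensor α M
  coact := cotensorCoact α M
  coassoc := by
    have key := subtype_comp_cotensorCoact α M
    set i := (cotensor α M).subtype
    have hinj : Function.Injective (i.rTensor (C ⊗[K] C)) :=
      Module.Flat.rTensor_preserves_injective_linearMap _ (Submodule.subtype_injective _)
    refine LinearMap.ext fun w => hinj ?_
    have n1 : ∀ t, i.rTensor (C ⊗[K] C) (TensorProduct.assoc K _ C C t) =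
        TensorProduct.assoc K _ C C ((i.rTensor C).rTensor C t) := by
      intro t
      have : i.rTensor (C ⊗[K] C) ∘ₗ (TensorProduct.assoc K _ C C).toLinearMap =
          (TensorProduct.assoc K _ C C).toLinearMap ∘ₗ (i.rTensor C).rTensor C :=
        TensorProduct.ext_threefold fun x y z => by simp
      exact LinearMap.congr_fun this t
    have n2 : ∀ t, i.rTensor (C ⊗[K] C)
          ((Coalgebra.comul (R := K) (A := C)).lTensor (cotensor α M) t) =
        (Coalgebra.comul (R := K) (A := C)).lTensor (M ⊗[K] C) (i.rTensor C t) := by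
      intro t
      rw [← LinearMap.comp_apply, LinearMap.rTensor_comp_lTensor, ← LinearMap.comp_apply,
        LinearMap.lTensor_comp_rTensor]
    have k : ∀ v, i.rTensor C (cotensorCoact α M v) = cofreeCoact K C M (i v) :=
      fun v => LinearMap.congr_fun key v
    have k2 : ∀ t, (i.rTensor C).rTensor C ((cotensorCoact α M).rTensor C t) =
        (cofreeCoact K C M).rTensor C (i.rTensor C t) := by
      intro t
      rw [← LinearMap.comp_apply, ← LinearMap.rTensor_comp, key, LinearMap.rTensor_comp,
        LinearMap.comp_apply]
    have := LinearMap.congr_fun (cofreeCoact_coassoc (K := K) (C := C) M) (i w)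
    simp only [LinearMap.comp_apply, LinearEquiv.coe_coe] at this ⊢
    rw [n1, n2, k2, k, this]
  counit := by
    have key := subtype_comp_cotensorCoact α M
    refine LinearMap.ext fun w => Subtype.val_injective ?_
    have n : ∀ t, (cotensor α M).subtype (TensorProduct.rid K _
          ((Coalgebra.counit (R := K) (A := C)).lTensor (cotensor α M) t)) =
        TensorProduct.rid K _ ((Coalgebra.counit (R := K) (A := C)).lTensor (M ⊗[K] C)
          ((cotensor α M).subtype.rTensor C t)) := by
      intro t
      induction t using TensorProduct.induction_on with
      | zero => simp
      | tmul x y => simp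
      | add p q hp hq => simp only [map_add, hp, hq]
    have k := LinearMap.congr_fun key w
    have := LinearMap.congr_fun (cofreeCoact_counit (K := K) (C := C) M) (w : M ⊗[K] C)
    simp only [LinearMap.comp_apply] at k
    refine (n _).trans ?_
    rw [k]
    exact this

theorem rTensor_mem_cotensor (α : C →ₗc[K] D) {M N : RightComod K D} (f : M ⟶ N)
    (w : M ⊗[K] C) (hw : w ∈ cotensor α M) : f.toLin.rTensor C w ∈ cotensor α N := by
  rw [mem_cotensor] at hw ⊢
  have h1 : N.coact.rTensor C (f.toLin.rTensor C w) =
      (f.toLin.rTensor D).rTensor C (M.coact.rTensor C w) := by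
    rw [← LinearMap.comp_apply, ← LinearMap.rTensor_comp, f.comm, LinearMap.rTensor_comp,
      LinearMap.comp_apply]
  have h2 : ∀ t, TensorProduct.assoc K N D C ((f.toLin.rTensor D).rTensor C t) =
      f.toLin.rTensor (D ⊗[K] C) (TensorProduct.assoc K M D C t) := by
    intro t
    have : (TensorProduct.assoc K N D C).toLinearMap ∘ₗ (f.toLin.rTensor D).rTensor C =
        f.toLin.rTensor (D ⊗[K] C) ∘ₗ (TensorProduct.assoc K M D C).toLinearMap :=
      TensorProduct.ext_threefold fun x y z => by simp
    exact LinearMap.congr_fun this t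
  rw [h1, h2, hw, ← LinearMap.comp_apply, LinearMap.rTensor_comp_lTensor,
    ← LinearMap.comp_apply, LinearMap.lTensor_comp_rTensor]

/-- The coinduction functor `α_* : 𝐌^D ⥤ 𝐌^C`, `M ↦ M □_D C`, `f ↦ f ⊗ id`. -/
noncomputable def coinduct (α : C →ₗc[K] D) : RightComod K D ⥤ RightComod K C where
  obj M := coinductObj α M
  map {M N} f := ⟨(f.toLin.rTensor C).restrict (rTensor_mem_cotensor α f), by
    set r := (f.toLin.rTensor C).restrict (rTensor_mem_cotensor α f)
    have hr : (cotensor α N).subtype ∘ₗ r = f.toLin.rTensor C ∘ₗ (cotensor α M).subtype := rfl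
    refine LinearMap.ext fun w => cotensor_rTensor_injective α N ?_
    have k1 := LinearMap.congr_fun (subtype_comp_cotensorCoact α N) (r w)
    have k2 := LinearMap.congr_fun (subtype_comp_cotensorCoact α M) w
    have k3 := LinearMap.congr_fun (cofreeCoact_naturality (C := C) f.toLin) (w : M ⊗[K] C)
    have k4 : ∀ t, (cotensor α N).subtype.rTensor C (r.rTensor C t) =
        (f.toLin.rTensor C).rTensor C ((cotensor α M).subtype.rTensor C t) := by
      intro t
      rw [← LinearMap.comp_apply, ← LinearMap.rTensor_comp, hr, LinearMap.rTensor_comp,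
        LinearMap.comp_apply]
    simp only [LinearMap.comp_apply] at k1 k2 k3 ⊢
    rw [k4]
    refine k1.trans (Eq.trans ?_ (congrArg ((f.toLin.rTensor C).rTensor C) k2.symm))
    exact k3.symm⟩
  map_id M := by
    refine hom_ext (LinearMap.ext fun w => Subtype.val_injective ?_)
    change (LinearMap.id : M →ₗ[K] M).rTensor C (w : M ⊗[K] C) = w
    simp
  map_comp {M N P} f g := by
    refine hom_ext (LinearMap.ext fun w => Subtype.val_injective ?_)
    change (g.toLin ∘ₗ f.toLin).rTensor C (w : M ⊗[K] C) =
      g.toLin.rTensor C (f.toLin.rTensor C (w : M ⊗[K] C))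
    rw [LinearMap.rTensor_comp, LinearMap.comp_apply]

/-- The linear map `M → N` underlying a morphism `α^* M → N` of `D`-comodules. -/
def corestrictLin {α : C →ₗc[K] D} {M : RightComod K C} {N : RightComod K D}
    (f : (corestrict α).obj M ⟶ N) : M →ₗ[K] N :=
  f.toLin

theorem transpose_mem (α : C →ₗc[K] D) {M : RightComod K C} {N : RightComod K D}
    (f : (corestrict α).obj M ⟶ N) (m : M) :
    (corestrictLin f).rTensor C (M.coact m) ∈ cotensor α N := by
  let g : M →ₗ[K] N := corestrictLin f
  change g.rTensor C (M.coact m) ∈ cotensor α N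
  have hg : N.coact ∘ₗ g = g.rTensor D ∘ₗ α.toLinearMap.lTensor M ∘ₗ M.coact := f.comm
  have n : ∀ t, TensorProduct.assoc K N D C
        ((g.rTensor D).rTensor C ((α.toLinearMap.lTensor M).rTensor C t)) =
      TensorProduct.map g (α.toLinearMap.rTensor C) (TensorProduct.assoc K M C C t) := by
    intro t
    have : (TensorProduct.assoc K N D C).toLinearMap ∘ₗ (g.rTensor D).rTensor C ∘ₗ
          (α.toLinearMap.lTensor M).rTensor C =
        TensorProduct.map g (α.toLinearMap.rTensor C) ∘ₗ
          (TensorProduct.assoc K M C C).toLinearMap :=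
      TensorProduct.ext_threefold fun x y z => by simp
    exact LinearMap.congr_fun this t
  have h := LinearMap.congr_fun M.coassoc m
  simp only [LinearMap.comp_apply, LinearEquiv.coe_coe] at h
  rw [mem_cotensor, ← LinearMap.comp_apply (N.coact.rTensor C), ← LinearMap.rTensor_comp, hg,
    LinearMap.rTensor_comp, LinearMap.rTensor_comp, LinearMap.comp_apply, LinearMap.comp_apply,
    n, h]
  have e : ∀ t : M ⊗[K] C, TensorProduct.map g (α.toLinearMap.rTensor C)
        ((Coalgebra.comul (R := K) (A := C)).lTensor M t) =
      (leftCoaction α).lTensor N (g.rTensor C t) := by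
    intro t
    have : TensorProduct.map g (α.toLinearMap.rTensor C) ∘ₗ
          (Coalgebra.comul (R := K) (A := C)).lTensor M =
        (leftCoaction α).lTensor N ∘ₗ g.rTensor C :=
      TensorProduct.ext' fun x y => by simp [leftCoaction]
    exact LinearMap.congr_fun this t
  exact e _

/-- The morphism `M → α_* N = N □_D C`, `m ↦ (f ⊗ id)(ρ^M m)`, corresponding to `f : α^* M → N`
under the adjunction between corestriction and coinduction. -/
noncomputable def transpose (α : C →ₗc[K] D) {M : RightComod K C} {N : RightComod K D}
    (f : (corestrict α).obj M ⟶ N) : M ⟶ (coinduct α).obj N :=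
  ⟨((corestrictLin f).rTensor C ∘ₗ M.coact).codRestrict (cotensor α N)
      (transpose_mem α f), by
    let g : M →ₗ[K] N := corestrictLin f
    set r := ((corestrictLin f).rTensor C ∘ₗ M.coact).codRestrict (cotensor α N)
      (transpose_mem α f)
    have hr : (cotensor α N).subtype ∘ₗ r = g.rTensor C ∘ₗ M.coact := rfl
    refine LinearMap.ext fun m => cotensor_rTensor_injective α N ?_
    have k1 := LinearMap.congr_fun (subtype_comp_cotensorCoact α N) (r m)
    have k3 := LinearMap.congr_fun (cofreeCoact_naturality (C := C) g) (M.coact m)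
    have k4 : ∀ t, (cotensor α N).subtype.rTensor C (r.rTensor C t) =
        (g.rTensor C).rTensor C (M.coact.rTensor C t) := by
      intro t
      rw [← LinearMap.comp_apply, ← LinearMap.rTensor_comp, hr, LinearMap.rTensor_comp,
        LinearMap.comp_apply]
    have k5 : cofreeCoact K C M (M.coact m) = M.coact.rTensor C (M.coact m) := by
      have h := LinearMap.congr_fun M.coassoc m
      simp only [LinearMap.comp_apply, LinearEquiv.coe_coe] at h
      rw [cofreeCoact, LinearMap.comp_apply, ← h, LinearEquiv.coe_coe,
        LinearEquiv.symm_apply_apply]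
    simp only [LinearMap.comp_apply] at k1 k3
    refine k1.trans (k3.symm.trans ?_)
    rw [k5]
    exact (k4 _).symm⟩

end RightComod

section Properties

variable {K : Type u} [Field K]
variable {C : Type u} [AddCommGroup C] [Module K C] [Coalgebra K C]
variable {D : Type u} [AddCommGroup D] [Module K D] [Coalgebra K D]

/-- A coalgebra morphism `α : C → D` is left coflat if the coinduction functor
`α_* = - □_D C` is exact: it takes exact sequences of right `D`-comodules to exact sequences. -/
def IsLeftCoflat (α : C →ₗc[K] D) : Prop :=
  ∀ ⦃M N P : RightComod K D⦄ (f : M ⟶ N) (g : N ⟶ P), Function.Exact f.toLin g.toLin →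
    Function.Exact ((RightComod.coinduct α).map f).toLin ((RightComod.coinduct α).map g).toLin

/-- A coalgebra `C` is (right) semiperfect if the category of right `C`-comodules has enough
projectives. -/
def IsSemiperfectCoalgebra (K : Type u) [Field K] (C : Type u) [AddCommGroup C] [Module K C]
    [Coalgebra K C] : Prop :=
  EnoughProjectives (RightComod K C)

end Properties

/-! ## Cis-comodules over a coalgebra representation -/

/-- A right cis-comodule over a coalgebra representation `C : X ⥤ Coalg`: comodules `M_x` and
morphisms `M^α : α^* M_x → M_y` of `C_y`-comodules with `M^{id} = id` and
`M^{βα} = M^β ∘ β^*(M^α)`. The morphisms `M_α : M_x → α_* M_y` are the transposes of the `M^α`. -/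
structure CisComod {K : Type u} [Field K] {X : Type u} [SmallCategory X]
    (C : X ⥤ CoalgCat.{u} K) where
  obj (x : X) : RightComod K (C.obj x)
  map {x y : X} (α : x ⟶ y) :
    (RightComod.corestrict (C.map α).toCoalgHom).obj (obj x) ⟶ obj y
  map_id (x : X) : RightComod.corestrictLin (map (𝟙 x)) = LinearMap.id
  map_comp {x y z : X} (α : x ⟶ y) (β : y ⟶ z) :
    RightComod.corestrictLin (map (α ≫ β)) =
      RightComod.corestrictLin (map β) ∘ₗ RightComod.corestrictLin (map α)

namespace CisComod

variable {K : Type u} [Field K] {X : Type u} [SmallCategory X] {C : X ⥤ CoalgCat.{u} K}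

/-- Morphisms of cis-comodules: families `η_x : M_x → N_x` of morphisms of `C_x`-comodules with
`η_y ∘ M^α = N^α ∘ α^*(η_x)`. -/
@[ext]
structure Hom (M N : CisComod C) where
  app (x : X) : M.obj x ⟶ N.obj x
  naturality {x y : X} (α : x ⟶ y) :
    M.map α ≫ app y = (RightComod.corestrict (C.map α).toCoalgHom).map (app x) ≫ N.map α

/-- The category of right cis-comodules over `C`. -/
instance : Category (CisComod C) where
  Hom := Hom
  id M := ⟨fun x => 𝟙 _, fun α => by simp⟩
  comp f g := ⟨fun x => f.app x ≫ g.app x, fun α => by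
    rw [← Category.assoc, f.naturality, Category.assoc, g.naturality, Functor.map_comp,
      Category.assoc]⟩

/-- The structure morphism `M_α : M_x → α_* M_y = M_y □_{C_y} C_x`. -/
noncomputable def coindMap (M : CisComod C) {x y : X} (α : x ⟶ y) :
    M.obj x ⟶ (RightComod.coinduct (C.map α).toCoalgHom).obj (M.obj y) :=
  RightComod.transpose (C.map α).toCoalgHom (M.map α)

variable (C) in
/-- A cis-comodule `M` is cartesian if every `M_α : M_x → α_* M_y` is an isomorphism. -/
def isCartesian : ObjectProperty (CisComod C) := fun M =>
  ∀ ⦃x y : X⦄ (α : x ⟶ y), IsIso (M.coindMap α)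

end CisComod

/-- The category of cartesian cis-comodules, a full subcategory of the category of
cis-comodules. -/
abbrev CartesianCisComod {K : Type u} [Field K] {X : Type u} [SmallCategory X]
    (C : X ⥤ CoalgCat.{u} K) : Type (u + 1) :=
  (CisComod.isCartesian C).FullSubcategory

/-! A cis-comodule is a functor `F` from `X` to vector spaces with a natural coaction `F_x → F_x ⊗
C_x`, that is, a coalgebra over the comonad `F ↦ (x ↦ F_x ⊗ C_x)` on `X ⥤ ModuleCat K`. Over a field
this comonad preserves finite limits, so the forgetful functor creates colimits and finite limits.
It is therefore exact and conservative, and `CisComod C` inherits from functors to vector spaces the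
abelian structure and colimits computed pointwise.

Being cartesian means that `M_x → M_y ⊗ C_x ⇉ M_y ⊗ C_y ⊗ C_x` is an equalizer for each arrow. All
three terms commute with finite limits and filtered colimits in `M`, so cartesian objects are closed
under both. They are closed under cokernels because coflatness makes coinduction exact
(`isClosedUnderCokernels`). Hence they form an abelian category with filtered colimits, thus with
all small colimits, and AB5 is reflected from functors to vector spaces.

The generator comes from a cardinality bound. Let `κ` be infinite and bound `K`, the arrows of `X`
and every `C_x`. Closing an element under coactions, structure maps and preimages along `M_x → M_y ⊗
C_x` gives a cartesian subobject of size at most `κ` at each `x` (`exists_isSaturated`,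
`isCartesian_sub`). Objects of that size form a set up to isomorphism, and the coproduct of
representatives is a separator. -/

open Limits Cardinal

/-! ### Comodules as coalgebras over the comonad `- ⊗ C`. -/

namespace RightComod

variable {K : Type u} [Field K]
variable {C : Type u} [AddCommGroup C] [Module K C] [Coalgebra K C]
variable {D : Type u} [AddCommGroup D] [Module K D] [Coalgebra K D]

/-- The counit `id ⊗ ε : V ⊗ C → V` of the comonad `- ⊗ C`. -/
noncomputable def cofreeCounit (K : Type u) [Field K] (C : Type u) [AddCommGroup C] [Module K C]
    [Coalgebra K C] (V : Type u) [AddCommGroup V] [Module K V] : V ⊗[K] C →ₗ[K] V :=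
  (TensorProduct.rid K V).toLinearMap ∘ₗ (Coalgebra.counit (R := K) (A := C)).lTensor V

@[simp]
theorem cofreeCounit_tmul {V : Type u} [AddCommGroup V] [Module K V] (v : V) (c : C) :
    cofreeCounit K C V (v ⊗ₜ c) = Coalgebra.counit (R := K) c • v := by
  simp [cofreeCounit]

theorem cofreeCounit_map {V W : Type u} [AddCommGroup V] [Module K V] [AddCommGroup W]
    [Module K W] (f : V →ₗ[K] W) (α : C →ₗc[K] D) :
    cofreeCounit K D W ∘ₗ TensorProduct.map f α.toLinearMap = f ∘ₗ cofreeCounit K C V := by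
  refine TensorProduct.ext' fun v c => ?_
  simp

theorem cofreeCoact_tmul {V : Type u} [AddCommGroup V] [Module K V] (v : V) (c : C) :
    cofreeCoact K C V (v ⊗ₜ c) =
      (TensorProduct.assoc K V C C).symm (v ⊗ₜ Coalgebra.comul (R := K) c) := rfl

/-- Varying the space and the coalgebra at once gives both naturalities of the comultiplication of
the comonad: along arrows of `X`, and, with `α` the identity, along natural transformations. -/
theorem cofreeCoact_map {V W : Type u} [AddCommGroup V] [Module K V] [AddCommGroup W]
    [Module K W] (f : V →ₗ[K] W) (α : C →ₗc[K] D) :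
    cofreeCoact K D W ∘ₗ TensorProduct.map f α.toLinearMap =
      TensorProduct.map (TensorProduct.map f α.toLinearMap) α.toLinearMap ∘ₗ
        cofreeCoact K C V := by
  refine TensorProduct.ext' fun v c => ?_
  have h : Coalgebra.comul (R := K) (α c) =
      TensorProduct.map α.toLinearMap α.toLinearMap (Coalgebra.comul (R := K) c) :=
    (CoalgHomClass.map_comp_comul_apply α c).symm
  simp only [LinearMap.comp_apply, TensorProduct.map_tmul, cofreeCoact_tmul]
  change (TensorProduct.assoc K W D D).symm (f v ⊗ₜ Coalgebra.comul (R := K) (α c)) = _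
  rw [h]
  induction Coalgebra.comul (R := K) c using TensorProduct.induction_on with
  | zero => simp
  | tmul a b => simp
  | add a b ha hb => simp only [TensorProduct.tmul_add, map_add, ha, hb]

theorem rTensor_cofreeCounit_comp_cofreeCoact (V : Type u) [AddCommGroup V] [Module K V] :
    (cofreeCounit K C V).rTensor C ∘ₗ cofreeCoact K C V = LinearMap.id := by
  refine TensorProduct.ext' fun v c => ?_
  have h : ∀ t : C ⊗[K] C, (cofreeCounit K C V).rTensor C ((TensorProduct.assoc K V C C).symm
      (v ⊗ₜ t)) = v ⊗ₜ (TensorProduct.lid K C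
        ((Coalgebra.counit (R := K) (A := C)).rTensor C t)) := by
    intro t
    induction t using TensorProduct.induction_on with
    | zero => simp
    | tmul a b => simp [TensorProduct.smul_tmul]
    | add a b ha hb => simp only [TensorProduct.tmul_add, map_add, ha, hb]
  simp [cofreeCoact_tmul, h]

theorem cofreeCoact_coassoc' (V : Type u) [AddCommGroup V] [Module K V] :
    (cofreeCoact K C V).rTensor C ∘ₗ cofreeCoact K C V =
      cofreeCoact K C (V ⊗[K] C) ∘ₗ cofreeCoact K C V := by
  conv_rhs => rw [cofreeCoact, LinearMap.comp_assoc, ← cofreeCoact_coassoc]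
  ext : 1
  simp

theorem coassoc' (M : RightComod K C) :
    cofreeCoact K C M ∘ₗ M.coact = M.coact.rTensor C ∘ₗ M.coact := by
  rw [cofreeCoact, LinearMap.comp_assoc, ← M.coassoc]
  ext : 1
  simp

/-- A right comodule from a coaction satisfying the axioms in terms of the comonad `- ⊗ C`. -/
@[reducible]
def mk' (V : Type u) [AddCommGroup V] [Module K V] (ρ : V →ₗ[K] V ⊗[K] C)
    (h : cofreeCoact K C V ∘ₗ ρ = ρ.rTensor C ∘ₗ ρ) (h' : cofreeCounit K C V ∘ₗ ρ = LinearMap.id) :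
    RightComod K C where
  carrier := V
  coact := ρ
  coassoc := by
    rw [← h, cofreeCoact]
    ext : 1
    simp
  counit := h'

/-- A morphism `α^* M → N` from a linear map `M → N` compatible with the coactions along `α`. -/
def homOfLin (α : C →ₗc[K] D) {M : RightComod K C} {N : RightComod K D} (f : M →ₗ[K] N)
    (h : N.coact ∘ₗ f = TensorProduct.map f α.toLinearMap ∘ₗ M.coact) :
    (corestrict α).obj M ⟶ N :=
  ⟨f, by
    rw [← LinearMap.rTensor_comp_lTensor, LinearMap.comp_assoc] at h
    exact h⟩

end RightComod

/-! ### Cis-comodules as coalgebras over a comonad on functors to vector spaces. -/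

namespace CisComod

variable {K : Type u} [Field K] {X : Type u} [SmallCategory X] (C : X ⥤ CoalgCat.{u} K)

/-- The functor `x ↦ F_x ⊗ C_x`. -/
@[simps]
noncomputable def tensorObj (F : X ⥤ ModuleCat.{u} K) : X ⥤ ModuleCat.{u} K where
  obj x := ModuleCat.of K (F.obj x ⊗[K] C.obj x)
  map α := ModuleCat.ofHom (TensorProduct.map (F.map α).hom (C.map α).toCoalgHom.toLinearMap)
  map_id x := by
    ext : 1
    simp
  map_comp α β := by
    ext : 1
    simp [TensorProduct.map_comp]

/-- The endofunctor `F ↦ (x ↦ F_x ⊗ C_x)` of the category of functors to vector spaces. -/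
@[simps]
noncomputable def tensorFunctor : (X ⥤ ModuleCat.{u} K) ⥤ (X ⥤ ModuleCat.{u} K) where
  obj F := tensorObj C F
  map {F F'} η :=
    { app x := ModuleCat.ofHom ((η.app x).hom.rTensor (C.obj x))
      naturality x y α := by
        refine ModuleCat.hom_ext (TensorProduct.ext' fun m c => ?_)
        exact congr($(congr($(η.naturality α) m)) ⊗ₜ (C.map α).toCoalgHom c) }
  map_id F := by
    refine NatTrans.ext (funext fun x => ModuleCat.hom_ext (LinearMap.rTensor_id _ _))
  map_comp f g := by
    refine NatTrans.ext (funext fun x => ModuleCat.hom_ext (LinearMap.rTensor_comp _ _ _))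

/-- The comonad `F ↦ (x ↦ F_x ⊗ C_x)` on the category of functors to vector spaces. -/
noncomputable def tensorComonad : Comonad (X ⥤ ModuleCat.{u} K) where
  toFunctor := tensorFunctor C
  ε :=
    { app F :=
        { app x := ModuleCat.ofHom (RightComod.cofreeCounit K (C.obj x) (F.obj x))
          naturality _ _ α :=
            ModuleCat.hom_ext (RightComod.cofreeCounit_map (F.map α).hom (C.map α).toCoalgHom) }
      naturality _ _ η := NatTrans.ext (funext fun x => ModuleCat.hom_ext
        (RightComod.cofreeCounit_map (η.app x).hom (.id K (C.obj x)))) }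
  δ :=
    { app F :=
        { app x := ModuleCat.ofHom (RightComod.cofreeCoact K (C.obj x) (F.obj x))
          naturality _ _ α :=
            ModuleCat.hom_ext (RightComod.cofreeCoact_map (F.map α).hom (C.map α).toCoalgHom) }
      naturality _ _ η := NatTrans.ext (funext fun x => ModuleCat.hom_ext
        (RightComod.cofreeCoact_map (η.app x).hom (.id K (C.obj x)))) }
  coassoc F := NatTrans.ext (funext fun x => ModuleCat.hom_ext
    (RightComod.cofreeCoact_coassoc' (C := C.obj x) (F.obj x)))
  left_counit F := NatTrans.ext (funext fun x => ModuleCat.hom_ext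
    (RightComod.cofreeCoact_counit (C := C.obj x) (F.obj x)))
  right_counit F := NatTrans.ext (funext fun x => ModuleCat.hom_ext
    (RightComod.rTensor_cofreeCounit_comp_cofreeCoact (C := C.obj x) (F.obj x)))

variable {C}

/-- The functor to vector spaces underlying a cis-comodule. -/
def toFunctor (M : CisComod C) : X ⥤ ModuleCat.{u} K where
  obj x := ModuleCat.of K (M.obj x)
  map α := ModuleCat.ofHom (RightComod.corestrictLin (M.map α))
  map_id x := ModuleCat.hom_ext (M.map_id x)
  map_comp α β := ModuleCat.hom_ext (M.map_comp α β)

/-- Colinearity of the structure maps, read as naturality in `x` of the coaction `M_x → M_x ⊗ C_x`.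
-/
theorem coact_corestrictLin (M : CisComod C) {x y : X} (α : x ⟶ y) :
    (M.obj y).coact ∘ₗ RightComod.corestrictLin (M.map α) =
      TensorProduct.map (RightComod.corestrictLin (M.map α)) (C.map α).toCoalgHom.toLinearMap ∘ₗ
        (M.obj x).coact := by
  have h := (M.map α).comm
  refine h.trans ?_
  rw [← LinearMap.rTensor_comp_lTensor, LinearMap.comp_assoc]
  rfl

theorem corestrictLin_app (M N : CisComod C) (f : M ⟶ N) {x y : X} (α : x ⟶ y) :
    (f.app y).toLin ∘ₗ RightComod.corestrictLin (M.map α) =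
      RightComod.corestrictLin (N.map α) ∘ₗ (f.app x).toLin :=
  congrArg RightComod.Hom.toLin (f.naturality α)

variable (C)

/-- Cis-comodules are coalgebras over the comonad `F ↦ (x ↦ F_x ⊗ C_x)`. -/
noncomputable def toCoalgebra : CisComod C ⥤ (tensorComonad C).Coalgebra where
  obj M :=
    { A := M.toFunctor
      a :=
        { app x := ModuleCat.ofHom (M.obj x).coact
          naturality _ _ α := ModuleCat.hom_ext (M.coact_corestrictLin α) }
      counit := NatTrans.ext (funext fun x => ModuleCat.hom_ext (M.obj x).counit)
      coassoc := NatTrans.ext (funext fun x => ModuleCat.hom_ext (M.obj x).coassoc') }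
  map {M N} f :=
    { f :=
        { app x := ModuleCat.ofHom (f.app x).toLin
          naturality _ _ α := ModuleCat.hom_ext (corestrictLin_app M N f α) }
      h := NatTrans.ext (funext fun x => ModuleCat.hom_ext (f.app x).comm.symm) }

instance : (toCoalgebra C).Faithful where
  map_injective h := Hom.ext (funext fun x => RightComod.hom_ext
    congr(ModuleCat.Hom.hom (NatTrans.app (Comonad.Coalgebra.Hom.f $h) x)))

instance : (toCoalgebra C).Full where
  map_surjective f :=
    ⟨{ app x := ⟨(f.f.app x).hom, congr(ModuleCat.Hom.hom (NatTrans.app $(f.h) x)).symm⟩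
       naturality α := RightComod.hom_ext
        congr(ModuleCat.Hom.hom $(f.f.naturality α)) }, rfl⟩

/-- The cis-comodule of a coalgebra over the comonad `F ↦ (x ↦ F_x ⊗ C_x)`. -/
noncomputable def ofCoalgebra (A : (tensorComonad C).Coalgebra) : CisComod C where
  obj x := RightComod.mk' (A.A.obj x) (A.a.app x).hom
    congr(ModuleCat.Hom.hom (NatTrans.app $(A.coassoc) x))
    congr(ModuleCat.Hom.hom (NatTrans.app $(A.counit) x))
  map α := RightComod.homOfLin (C.map α).toCoalgHom (A.A.map α).hom
    congr(ModuleCat.Hom.hom $(A.a.naturality α))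
  map_id x := congr(ModuleCat.Hom.hom $(A.A.map_id x))
  map_comp α β := congr(ModuleCat.Hom.hom $(A.A.map_comp α β))

instance : (toCoalgebra C).EssSurj where
  mem_essImage A := ⟨ofCoalgebra C A, ⟨Iso.refl A⟩⟩

instance : (toCoalgebra C).IsEquivalence where

end CisComod

/-! ### The abelian structure on cis-comodules. -/

namespace CategoryTheory

universe v₁ v₂ u₁ u₂

/-- A preadditive category with finite limits and colimits is abelian if it has an additive functor
to an abelian category which preserves finite limits and colimits and reflects isomorphisms. -/
noncomputable abbrev abelianOfReflectsIsomorphisms {A : Type u₁} [Category.{v₁} A] [Preadditive A]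
    [HasFiniteLimits A] [HasFiniteColimits A] {B : Type u₂} [Category.{v₂} B] [Abelian B]
    (U : A ⥤ B) [U.Additive] [PreservesFiniteLimits U] [PreservesFiniteColimits U]
    [U.ReflectsIsomorphisms] : Abelian A := by
  have : ∀ {X Y : A} (f : X ⟶ Y), IsIso (Abelian.coimageImageComparison f) := fun f => by
    have : IsIso (U.map (Abelian.coimageImageComparison f)) := by
      -- An exact functor takes the coimage-image comparison of `f` to that of `U.map f`, which is
      -- invertible because `B` is abelian.
      rw [Arrow.isIso_iff_isIso_of_isIso (Abelian.PreservesCoimageImageComparison.iso U f).hom]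
      infer_instance
    exact isIso_of_reflects_iso _ U
  exact Abelian.ofCoimageImageComparisonIsIso

end CategoryTheory

namespace CisComod

variable {K : Type u} [Field K] {X : Type u} [SmallCategory X] (C : X ⥤ CoalgCat.{u} K)

/-- Limits of functors are pointwise, and tensoring with a vector space is exact. -/
instance : PreservesFiniteLimits (tensorFunctor C) where
  preservesFiniteLimits J _ _ :=
    preservesLimitsOfShape_of_evaluation _ _ fun x =>
      inferInstanceAs (PreservesLimitsOfShape J
        ((evaluation X (ModuleCat.{u} K)).obj x ⋙
          MonoidalCategory.tensorRight (ModuleCat.of K (C.obj x))))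

instance : PreservesFiniteLimits (tensorComonad C).toFunctor :=
  inferInstanceAs (PreservesFiniteLimits (tensorFunctor C))

instance : (tensorComonad C).toFunctor.Additive :=
  Functor.additive_of_preserves_binary_products _

noncomputable instance : Preadditive (CisComod C) :=
  .ofFullyFaithful (.ofFullyFaithful (toCoalgebra C))

instance : (toCoalgebra C).Additive :=
  (Functor.FullyFaithful.ofFullyFaithful (toCoalgebra C)).additive_ofFullyFaithful

/-- The forgetful functor from cis-comodules to functors to vector spaces. -/
noncomputable abbrev forget : CisComod C ⥤ X ⥤ ModuleCat.{u} K :=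
  toCoalgebra C ⋙ Comonad.forget (tensorComonad C)

instance : HasColimitsOfSize.{u, u} (tensorComonad C).Coalgebra :=
  hasColimits_of_hasColimits_createsColimits (Comonad.forget (tensorComonad C))

/-- The forgetful functor of a comonad creates those limits that the comonad preserves. -/
instance : HasFiniteLimits (tensorComonad C).Coalgebra where
  out _ _ _ :=
    hasLimitsOfShape_of_hasLimitsOfShape_createsLimitsOfShape (Comonad.forget (tensorComonad C))

instance : HasColimitsOfSize.{u, u} (CisComod C) :=
  Adjunction.has_colimits_of_equivalence (toCoalgebra C)

instance : HasFiniteLimits (CisComod C) where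
  out _ _ _ := Adjunction.hasLimitsOfShape_of_equivalence (toCoalgebra C)

instance : PreservesFiniteLimits (Comonad.forget (tensorComonad C)) where
  preservesFiniteLimits _ _ _ := inferInstance

noncomputable instance : Abelian (CisComod C) :=
  abelianOfReflectsIsomorphisms (forget C)

end CisComod

/-! ### Pointwise equalizer conditions under limits and filtered colimits. -/

namespace ModuleCat

universe v w

variable {K : Type u} [Field K] {A : Type v} [Category.{w} A]
  {F T T' : A ⥤ ModuleCat.{u} K} (i : F ⟶ T) (f g : T ⟶ T')

/-- The objects at which a natural transformation `i` is injective with range the locus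
where `f` and `g` agree. -/
def isEqualizerAt : ObjectProperty A := fun M =>
  Function.Injective (i.app M) ∧ ∀ w : T.obj M, f.app M w = g.app M w → ∃ m, i.app M m = w

variable {i f g}

/-- Injectivity is tested on components. Solutions on the components are unique, hence compatible,
and glue to a solution on the limit. The equation `f = g` only has to be pushed to the components,
so `T'` need not preserve the limit. -/
theorem isEqualizerAt_of_isLimit {J : Type} [SmallCategory J] {D : J ⥤ A}
    {c : Cone D} (hc : IsLimit c)
    [PreservesLimit D F] [PreservesLimit D T]
    (hD : ∀ j, isEqualizerAt i f g (D.obj j)) : isEqualizerAt i f g c.pt := by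
  have hF := isLimitOfPreserves (CategoryTheory.forget _) (isLimitOfPreserves F hc)
  have hT : ∀ a b : T.obj c.pt, (∀ j, T.map (c.π.app j) a = T.map (c.π.app j) b) → a = b :=
    fun a b h => Concrete.isLimit_ext _ (isLimitOfPreserves T hc) a b h
  have nat {M N : A} (φ : M ⟶ N) (m) : i.app N (F.map φ m) = T.map φ (i.app M m) :=
    congr($(i.naturality φ) m)
  have natf {M N : A} (φ : M ⟶ N) (m) : f.app N (T.map φ m) = T'.map φ (f.app M m) :=
    congr($(f.naturality φ) m)
  have natg {M N : A} (φ : M ⟶ N) (m) : g.app N (T.map φ m) = T'.map φ (g.app M m) :=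
    congr($(g.naturality φ) m)
  constructor
  · intro a b hab
    refine Concrete.isLimit_ext _ (isLimitOfPreserves F hc) a b fun j => (hD j).1 ?_
    exact (nat _ a).trans ((congrArg _ hab).trans (nat _ b).symm)
  · intro w hw
    have h (j : J) : ∃ m, i.app (D.obj j) m = T.map (c.π.app j) w :=
      (hD j).2 _ ((natf _ w).trans ((congrArg _ hw).trans (natg _ w).symm))
    choose m hm using h
    let s : (D ⋙ F ⋙ CategoryTheory.forget (ModuleCat.{u} K)).sections :=
      ⟨m, fun {j k} φ => (hD k).1 (by
        refine (nat (D.map φ) (m j)).trans ?_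
        rw [hm, hm, ← c.w φ, T.map_comp]
        rfl)⟩
    refine ⟨(Types.isLimitEquivSections hF).symm s, hT _ _ fun j => ?_⟩
    refine (nat (c.π.app j) _).symm.trans (Eq.trans (congrArg _ ?_) (hm j))
    exact Types.isLimitEquivSections_symm_apply hF s j

/-- Elements and equations live at a finite stage. Here `T'` must preserve the colimit, since the
equation `f = g` has to be pulled back to a stage. -/
theorem isEqualizerAt_of_isColimit {J : Type u} [SmallCategory J] [IsFiltered J]
    {D : J ⥤ A} {c : Cocone D} (hc : IsColimit c)
    [PreservesColimit D F] [PreservesColimit D T] [PreservesColimit D T']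
    (hD : ∀ j, isEqualizerAt i f g (D.obj j)) : isEqualizerAt i f g c.pt := by
  have nat {M N : A} (φ : M ⟶ N) (m) : i.app N (F.map φ m) = T.map φ (i.app M m) :=
    congr($(i.naturality φ) m)
  have natf {M N : A} (φ : M ⟶ N) (m) : f.app N (T.map φ m) = T'.map φ (f.app M m) :=
    congr($(f.naturality φ) m)
  have natg {M N : A} (φ : M ⟶ N) (m) : g.app N (T.map φ m) = T'.map φ (g.app M m) :=
    congr($(g.naturality φ) m)
  have hF := isColimitOfPreserves F hc
  have hT := isColimitOfPreserves T hc
  have hT' := isColimitOfPreserves T' hc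
  constructor
  · rw [injective_iff_map_eq_zero]
    intro a ha
    obtain ⟨j, a, rfl⟩ := Concrete.isColimit_exists_rep _ hF a
    have ha' : T.map (c.ι.app j) (i.app _ a) = T.map (c.ι.app j) 0 := by
      rw [← nat, map_zero]
      exact ha
    obtain ⟨k, p, q, h⟩ := Concrete.isColimit_exists_of_rep_eq _ hT _ _ ha'
    have h0 : F.map (D.map p) a = 0 := (hD k).1 (by
      rw [nat, map_zero]
      exact h.trans (map_zero _))
    change F.map (c.ι.app j) a = 0
    rw [← c.w p, F.map_comp, ModuleCat.comp_apply, h0, map_zero]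
  · intro w hw
    obtain ⟨j, w, rfl⟩ := Concrete.isColimit_exists_rep _ hT w
    have hw' : T'.map (c.ι.app j) (f.app _ w) = T'.map (c.ι.app j) (g.app _ w) := by
      rw [← natf, ← natg]
      exact hw
    obtain ⟨k, p, q, h⟩ := Concrete.isColimit_exists_of_rep_eq _ hT' _ _ hw'
    -- The two sides of the equation may reach stage `k` along different arrows; one more step makes
    -- these equal.
    let r := IsFiltered.coeqHom p q
    have e : p ≫ r = q ≫ r := IsFiltered.coeq_condition p q
    obtain ⟨m, hm⟩ := (hD _).2 (T.map (D.map (p ≫ r)) w) (by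
      rw [natf, natg]
      conv_rhs => rw [e]
      simp only [D.map_comp, T'.map_comp, ModuleCat.comp_apply]
      exact congrArg _ h)
    refine ⟨F.map (c.ι.app _) m, ?_⟩
    rw [nat, hm, ← ModuleCat.comp_apply, ← T.map_comp, c.w]
    rfl

end ModuleCat

/-! ### Cartesianness as an equalizer condition. -/

namespace RightComod

variable {K : Type u} [Field K]
variable {C : Type u} [AddCommGroup C] [Module K C] [Coalgebra K C]
variable {D : Type u} [AddCommGroup D] [Module K D] [Coalgebra K D]

/-- The linear inverse of a bijective comodule map is automatically colinear. -/
theorem isIso_iff_bijective {M N : RightComod K C} (f : M ⟶ N) :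
    IsIso f ↔ Function.Bijective f.toLin := by
  constructor
  · intro _
    refine Function.bijective_iff_has_inverse.2 ⟨(inv f).toLin, fun m => ?_, fun m => ?_⟩
    · exact congr(($(IsIso.hom_inv_id f)).toLin m)
    · exact congr(($(IsIso.inv_hom_id f)).toLin m)
  · intro h
    let e := LinearEquiv.ofBijective f.toLin h
    have h₁ : e.symm.toLinearMap ∘ₗ f.toLin = LinearMap.id :=
      LinearMap.ext fun m => e.symm_apply_apply m
    have h₂ : f.toLin ∘ₗ e.symm.toLinearMap = LinearMap.id :=
      LinearMap.ext fun m => e.apply_symm_apply m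
    refine ⟨⟨e.symm.toLinearMap, ?_⟩, hom_ext h₁, hom_ext h₂⟩
    rw [← LinearMap.cancel_right e.surjective]
    change (M.coact ∘ₗ e.symm.toLinearMap) ∘ₗ f.toLin =
      (e.symm.toLinearMap.rTensor C ∘ₗ N.coact) ∘ₗ f.toLin
    rw [LinearMap.comp_assoc, h₁, LinearMap.comp_assoc, f.comm, ← LinearMap.comp_assoc,
      ← LinearMap.rTensor_comp, h₁, LinearMap.rTensor_id, LinearMap.comp_id, LinearMap.id_comp]

theorem assoc_coact_naturality {M N : RightComod K C} (f : M ⟶ N) (V : Type u) [AddCommGroup V]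
    [Module K V] :
    ((TensorProduct.assoc K N C V).toLinearMap ∘ₗ N.coact.rTensor V) ∘ₗ f.toLin.rTensor V =
      f.toLin.rTensor (C ⊗[K] V) ∘ₗ
        (TensorProduct.assoc K M C V).toLinearMap ∘ₗ M.coact.rTensor V := by
  have h : (TensorProduct.assoc K N C V).toLinearMap ∘ₗ (f.toLin.rTensor C).rTensor V =
      f.toLin.rTensor (C ⊗[K] V) ∘ₗ (TensorProduct.assoc K M C V).toLinearMap :=
    TensorProduct.ext_threefold fun x y z => by simp
  rw [LinearMap.comp_assoc, ← LinearMap.rTensor_comp, f.comm, LinearMap.rTensor_comp,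
    ← LinearMap.comp_assoc, h, LinearMap.comp_assoc]

/-- The zero comodule. -/
@[reducible]
def zero (K : Type u) [Field K] (C : Type u) [AddCommGroup C] [Module K C] [Coalgebra K C] :
    RightComod K C where
  carrier := PUnit
  coact := 0
  coassoc := by simp
  counit := LinearMap.ext fun _ => rfl

end RightComod

namespace CisComod

variable {K : Type u} [Field K] {X : Type u} [SmallCategory X] {C : X ⥤ CoalgCat.{u} K}

/-- The linear map `M_x → M_y ⊗ C_x` underlying the structure morphism `M_x → M_y □ C_x`. -/
def coindLin (M : CisComod C) {x y : X} (α : x ⟶ y) : M.obj x →ₗ[K] M.obj y ⊗[K] C.obj x :=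
  (RightComod.corestrictLin (M.map α)).rTensor (C.obj x) ∘ₗ (M.obj x).coact

theorem coindLin_mem (M : CisComod C) {x y : X} (α : x ⟶ y) (m : M.obj x) :
    M.coindLin α m ∈ RightComod.cotensor (C.map α).toCoalgHom (M.obj y) :=
  RightComod.transpose_mem _ _ m

theorem coindLin_app {M N : CisComod C} (η : M ⟶ N) {x y : X} (α : x ⟶ y) (m : M.obj x) :
    N.coindLin α ((η.app x).toLin m) =
      (η.app y).toLin.rTensor (C.obj x) (M.coindLin α m) := by
  have h : N.coindLin α ∘ₗ (η.app x).toLin =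
      (η.app y).toLin.rTensor (C.obj x) ∘ₗ M.coindLin α := by
    rw [coindLin, LinearMap.comp_assoc, (η.app x).comm, ← LinearMap.comp_assoc,
      ← LinearMap.rTensor_comp, ← corestrictLin_app, LinearMap.rTensor_comp, LinearMap.comp_assoc]
    rfl
  exact congr($h m)

theorem isIso_coindMap_iff (M : CisComod C) {x y : X} (α : x ⟶ y) :
    IsIso (M.coindMap α) ↔ Function.Injective (M.coindLin α) ∧
      ∀ w ∈ RightComod.cotensor (C.map α).toCoalgHom (M.obj y), ∃ m, M.coindLin α m = w := by
  rw [RightComod.isIso_iff_bijective]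
  constructor
  · intro h
    refine ⟨fun a b hab => h.1 (Subtype.ext hab), fun w hw => ?_⟩
    obtain ⟨m, hm⟩ := h.2 ⟨w, hw⟩
    exact ⟨m, congrArg Subtype.val hm⟩
  · intro h
    refine ⟨fun a b hab => h.1 (congrArg Subtype.val hab), fun w => ?_⟩
    obtain ⟨m, hm⟩ := h.2 w.1 w.2
    exact ⟨m, Subtype.ext hm⟩

variable (C)

/-- The functor `M ↦ M_x` to vector spaces. -/
noncomputable abbrev eval (x : X) : CisComod C ⥤ ModuleCat.{u} K :=
  forget C ⋙ (evaluation X (ModuleCat.{u} K)).obj x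

/-- The functor `M ↦ M_y ⊗ V`. -/
noncomputable abbrev evalTensor (y : X) (V : Type u) [AddCommGroup V] [Module K V] :
    CisComod C ⥤ ModuleCat.{u} K :=
  eval C y ⋙ MonoidalCategory.tensorRight (ModuleCat.of K V)

variable {C} {x y : X} (α : x ⟶ y)

/-- The natural map `M_x → M_y ⊗ C_x`. -/
noncomputable def coindNatTrans : eval C x ⟶ evalTensor C y (C.obj x) where
  app M := ModuleCat.ofHom (M.coindLin α)
  naturality _ _ η := ModuleCat.hom_ext (LinearMap.ext fun m => coindLin_app η α m)

/-- The natural map `M_y ⊗ C_x → M_y ⊗ C_y ⊗ C_x` given by the coaction on `M_y`. -/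
noncomputable def coactNatTrans :
    evalTensor C y (C.obj x) ⟶ evalTensor C y (C.obj y ⊗[K] C.obj x) where
  app M := ModuleCat.ofHom ((TensorProduct.assoc K (M.obj y) (C.obj y) (C.obj x)).toLinearMap ∘ₗ
    (M.obj y).coact.rTensor (C.obj x))
  naturality _ _ η := ModuleCat.hom_ext (RightComod.assoc_coact_naturality (η.app y) (C.obj x))

/-- The natural map `M_y ⊗ C_x → M_y ⊗ C_y ⊗ C_x` given by the left coaction on `C_x`. -/
noncomputable def leftCoactionNatTrans :
    evalTensor C y (C.obj x) ⟶ evalTensor C y (C.obj y ⊗[K] C.obj x) where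
  app M := ModuleCat.ofHom
    ((RightComod.leftCoaction (C.map α).toCoalgHom).lTensor (M.obj y))
  naturality _ _ _ := ModuleCat.hom_ext (TensorProduct.ext' fun _ _ => rfl)

/-- The cotensor product is by definition the locus where the last two maps agree. The functors
involved are evaluations tensored with fixed spaces, hence commute with finite limits and with
colimits. -/
theorem isCartesian_iff (M : CisComod C) : isCartesian C M ↔ ∀ ⦃x y : X⦄ (α : x ⟶ y),
    ModuleCat.isEqualizerAt (coindNatTrans α) (coactNatTrans (x := x)) (leftCoactionNatTrans α) M :=
  forall₃_congr fun _ _ α => M.isIso_coindMap_iff α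

/-! ### Closure properties of cartesian cis-comodules. -/

instance {J : Type} [SmallCategory J] [FinCategory J] :
    (isCartesian C).IsClosedUnderLimitsOfShape J where
  limitsOfShape_le := by
    rintro M ⟨p⟩
    rw [isCartesian_iff]
    intro x y α
    exact ModuleCat.isEqualizerAt_of_isLimit p.isLimit
      fun j => (isCartesian_iff _).1 (p.prop_diag_obj j) α

instance {J : Type u} [SmallCategory J] [IsFiltered J] :
    (isCartesian C).IsClosedUnderColimitsOfShape J where
  colimitsOfShape_le := by
    rintro M ⟨p⟩
    rw [isCartesian_iff]
    intro x y α
    exact ModuleCat.isEqualizerAt_of_isColimit p.isColimit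
      fun j => (isCartesian_iff _).1 (p.prop_diag_obj j) α

instance : (isCartesian C).IsClosedUnderKernels where
  kernels_le := by
    rintro _ ⟨f, k, hk, hf⟩
    refine (isCartesian C).prop_of_isLimit hk ?_
    rintro (_ | _)
    exacts [hf.1, hf.2]

instance : (isCartesian C).IsClosedUnderFiniteProducts where
  isClosedUnderLimitsOfShape J _ := by
    classical
    have := Fintype.ofFinite J
    infer_instance

instance : (isCartesian C).ContainsZero where
  exists_zero :=
    have hP : isCartesian C (⊤_ CisComod C) :=
      (isCartesian C).prop_limit (Functor.empty.{0} (CisComod C)) fun j => j.as.elim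
    ⟨_, (isZero_zero (CisComod C)).of_iso
      (terminalIsTerminal.uniqueUpToIso (isZero_zero (CisComod C)).isTerminal), hP⟩

theorem exact_of_isColimit_cokernelCofork {M N : CisComod C} {f : M ⟶ N} {k : CokernelCofork f}
    (hk : IsColimit k) (x : X) :
    Function.Exact (f.app x).toLin (k.π.app x).toLin ∧
      Function.Surjective (k.π.app x).toLin := by
  have h := CokernelCofork.mapIsColimit k hk (eval C x)
  have he := Cofork.IsColimit.epi h
  have hs := ShortComplex.exact_of_g_is_cokernel
    (ShortComplex.mk ((eval C x).map f) ((eval C x).map k.π) (by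
      rw [← Functor.map_comp, k.condition, Functor.map_zero])) h
  rw [CategoryTheory.ShortComplex.ShortExact.moduleCat_exact_iff_function_exact] at hs
  exact ⟨hs, (ModuleCat.epi_iff_surjective _).1 he⟩

/-- For `M → N → Q → 0` exact, coflatness keeps `M_y □ C_x → N_y □ C_x → Q_y □ C_x → 0` exact. The
maps from `M_x` and `N_x` are isomorphisms, so a diagram chase shows that the map from `Q_x` is one
too. -/
theorem isClosedUnderCokernels
    (hC : ∀ ⦃x y : X⦄ (α : x ⟶ y), IsLeftCoflat (C.map α).toCoalgHom) :
    (isCartesian C).IsClosedUnderCokernels where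
  cokernels_le := by
    rintro _ ⟨f, k, hk, hf⟩ x y α
    rename_i M N
    obtain ⟨hx, hx'⟩ := exact_of_isColimit_cokernelCofork hk x
    obtain ⟨hy, hy'⟩ := exact_of_isColimit_cokernelCofork hk y
    obtain ⟨hM, hM'⟩ := (M.isIso_coindMap_iff α).1 (hf.1 α)
    obtain ⟨hN, hN'⟩ := (N.isIso_coindMap_iff α).1 (hf.2 α)
    have e₁ := hC α _ _ hy
    -- Coflatness speaks of exact pairs only, so surjectivity of `N_y → Q_y` is encoded as exactness
    -- at `Q_y` with a zero map out.
    let z : k.pt.obj y ⟶ RightComod.zero K (C.obj y) := ⟨0, by simp⟩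
    have hz : Function.Exact (k.π.app y).toLin z.toLin := fun q =>
      ⟨fun _ => hy' q, fun _ => rfl⟩
    have e₂ := hC α _ _ hz
    rw [isIso_coindMap_iff]
    constructor
    · rw [injective_iff_map_eq_zero]
      intro q hq
      obtain ⟨n, rfl⟩ := hx' q
      rw [coindLin_app] at hq
      obtain ⟨w, hw⟩ := (e₁ ⟨N.coindLin α n, N.coindLin_mem α n⟩).1 (Subtype.ext hq)
      obtain ⟨m, hm⟩ := hM' w.1 w.2
      have hn : (f.app x).toLin m = n := hN (by
        rw [coindLin_app, hm]
        exact congrArg Subtype.val hw)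
      exact (hx n).2 ⟨m, hn⟩
    · intro w hw
      obtain ⟨v, hv⟩ := (e₂ ⟨w, hw⟩).1 (Subtype.ext
        congr($(LinearMap.rTensor_zero (C.obj x)) w))
      obtain ⟨n, hn⟩ := hN' v.1 v.2
      refine ⟨(k.π.app x).toLin n, ?_⟩
      rw [coindLin_app, hn]
      exact congrArg Subtype.val hv

/-! ### Finite limits, filtered colimits and AB5 for cartesian cis-comodules. -/

variable (C)

/-- The forgetful functor from cartesian cis-comodules to functors to vector spaces. -/
noncomputable abbrev forgetCartesian : CartesianCisComod C ⥤ X ⥤ ModuleCat.{u} K :=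
  (isCartesian C).ι ⋙ forget C

instance : HasFiniteLimits (CartesianCisComod C) where
  out _ _ _ := inferInstance

instance : HasFilteredColimitsOfSize.{u, u} (CartesianCisComod C) where
  HasColimitsOfShape _ _ _ := inferInstance

instance : PreservesFiniteLimits (isCartesian C).ι where
  preservesFiniteLimits _ _ _ := inferInstance

instance : ReflectsFiniteLimits (forgetCartesian C) where
  reflects _ _ _ := reflectsLimitsOfShape_of_reflectsIsomorphisms

/-- The forgetful functor preserves filtered colimits and both preserves and reflects finite limits,
so exactness of filtered colimits is checked in functors to vector spaces. -/
instance : AB5OfSize.{u, u} (CartesianCisComod C) where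
  ofShape J _ _ := HasExactColimitsOfShape.domain_of_functor J (forgetCartesian C)

end CisComod

/-! ### Cardinality bounds for spans and tensor products. -/

section Cardinality

variable {K : Type u} [Field K] {M N : Type u} [AddCommGroup M] [Module K M]
  [AddCommGroup N] [Module K N] {κ : Cardinal.{u}}

theorem Cardinal.mk_list_le_of_le {α : Type u} (hκ : ℵ₀ ≤ κ) (hα : #α ≤ κ) : #(List α) ≤ κ :=
  (mk_list_le_max α).trans (max_le hκ hα)

theorem Cardinal.mk_prod_le_of_le {α β : Type u} (hκ : ℵ₀ ≤ κ) (hα : #α ≤ κ) (hβ : #β ≤ κ) :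
    #(α × β) ≤ κ := by
  rw [← mul_def]
  exact (mul_le_mul' hα hβ).trans (mul_eq_self hκ).le

theorem Cardinal.mk_iUnion_le_of_le {ι α : Type u} {s : ι → Set α} (hκ : ℵ₀ ≤ κ) (hι : #ι ≤ κ)
    (hs : ∀ i, #(s i) ≤ κ) : #(⋃ i, s i) ≤ κ := by
  refine (mk_iUnion_le_sum_mk).trans ((sum_le_sum _ (fun _ => κ) hs).trans ?_)
  rw [sum_const']
  exact (mul_le_mul' hι le_rfl).trans (mul_eq_self hκ).le

theorem Cardinal.mk_union_le_of_le {α : Type u} {s t : Set α} (hκ : ℵ₀ ≤ κ) (hs : #s ≤ κ)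
    (ht : #t ≤ κ) : #(s ∪ t : Set α) ≤ κ :=
  (mk_union_le s t).trans (add_le_of_le hκ hs ht)

/-- Linear combinations are indexed by lists of pairs (scalar, vector), and an infinite `κ` absorbs
products and lists. -/
theorem Submodule.mk_span_le_of_le {s : Set M} (hκ : ℵ₀ ≤ κ) (hK : #K ≤ κ) (hs : #s ≤ κ) :
    #(span K s) ≤ κ := by
  refine le_trans ?_ (mk_list_le_of_le hκ (mk_prod_le_of_le hκ hK hs))
  let f : List (K × s) → span K s := fun l =>
    (l.map fun p => p.1 • (⟨p.2, subset_span p.2.2⟩ : span K s)).sum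
  refine mk_le_of_surjective (f := f) fun m => ?_
  suffices h : ∀ m ∈ span K s, ∃ l, (f l : M) = m from (h m m.2).imp fun l hl => Subtype.ext hl
  intro m hm
  induction hm using span_induction with
  | mem m hm => exact ⟨[(1, ⟨m, hm⟩)], by simp [f]⟩
  | zero => exact ⟨[], by simp [f]⟩
  | add a b _ _ ha hb =>
    obtain ⟨l, rfl⟩ := ha
    obtain ⟨l', rfl⟩ := hb
    exact ⟨l ++ l', by simp [f]⟩
  | smul k a _ ha =>
    obtain ⟨l, rfl⟩ := ha
    refine ⟨l.map fun p => (k * p.1, p.2), ?_⟩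
    simp [f, List.smul_sum, mul_smul, Function.comp_def]

theorem TensorProduct.mk_le_of_le (hκ : ℵ₀ ≤ κ) (hM : #M ≤ κ) (hN : #N ≤ κ) :
    #(M ⊗[K] N) ≤ κ := by
  refine le_trans ?_ (mk_list_le_of_le hκ (mk_prod_le_of_le hκ hM hN))
  let f : List (M × N) → M ⊗[K] N := fun l => (l.map fun p => p.1 ⊗ₜ p.2).sum
  refine mk_le_of_surjective (f := f) fun t => ?_
  induction t using TensorProduct.induction_on with
  | zero => exact ⟨[], by simp [f]⟩
  | tmul m n => exact ⟨[(m, n)], by simp [f]⟩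
  | add a b ha hb =>
    obtain ⟨l, rfl⟩ := ha
    obtain ⟨l', rfl⟩ := hb
    exact ⟨l ++ l', by simp [f]⟩

end Cardinality

/-! ### Subspaces of the form `V ⊗ W` in `M ⊗ W`. -/

namespace Submodule

variable {K : Type u} [Field K] {M N : Type u} [AddCommGroup M] [Module K M]
  [AddCommGroup N] [Module K N] (W : Type u) [AddCommGroup W] [Module K W]

/-- The subspace `V ⊗ W` of `M ⊗ W`, for `V ⊆ M`. -/
def tensorRange (V : Submodule K M) : Submodule K (M ⊗[K] W) :=
  LinearMap.range (V.subtype.rTensor W)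

variable {W}

theorem tensorRange_mono {V V' : Submodule K M} (h : V ≤ V') :
    V.tensorRange W ≤ V'.tensorRange W := by
  rintro _ ⟨t, rfl⟩
  refine ⟨(inclusion h).rTensor W t, ?_⟩
  rw [← LinearMap.comp_apply, ← LinearMap.rTensor_comp, subtype_comp_inclusion]

theorem tmul_mem_tensorRange {V : Submodule K M} {m : M} (hm : m ∈ V) (w : W) :
    m ⊗ₜ w ∈ V.tensorRange W :=
  ⟨⟨m, hm⟩ ⊗ₜ w, rfl⟩

/-- A tensor is a finite sum, so a countable increasing union is reached at a finite stage. This is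
why `ω` steps suffice for saturation. -/
theorem exists_mem_tensorRange_of_mem_iSup {V : ℕ → Submodule K M} (hV : Monotone V)
    {t : M ⊗[K] W} (ht : t ∈ (⨆ n, V n).tensorRange W) : ∃ n, t ∈ (V n).tensorRange W := by
  obtain ⟨t, rfl⟩ := ht
  induction t using TensorProduct.induction_on with
  | zero => exact ⟨0, by simp⟩
  | tmul m w =>
    obtain ⟨n, hn⟩ := (mem_iSup_of_directed V hV.directed_le).1 m.2
    exact ⟨n, tmul_mem_tensorRange hn w⟩
  | add a b ha hb =>
    obtain ⟨n, hn⟩ := ha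
    obtain ⟨n', hn'⟩ := hb
    rw [map_add]
    exact ⟨max n n', add_mem (tensorRange_mono (hV (le_max_left _ _)) hn)
      (tensorRange_mono (hV (le_max_right _ _)) hn')⟩

theorem exists_finset_mem_tensorRange (t : M ⊗[K] W) :
    ∃ s : Finset M, t ∈ (span K (s : Set M)).tensorRange W := by
  classical
  induction t using TensorProduct.induction_on with
  | zero => exact ⟨∅, zero_mem _⟩
  | tmul m w => exact ⟨{m}, tmul_mem_tensorRange (subset_span (by simp)) w⟩
  | add a b ha hb =>
    obtain ⟨s, hs⟩ := ha
    obtain ⟨s', hs'⟩ := hb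
    exact ⟨s ∪ s', add_mem (tensorRange_mono (span_mono (by simp)) hs)
      (tensorRange_mono (span_mono (by simp)) hs')⟩

theorem mk_tensorRange_le_of_le {V : Submodule K M} {κ : Cardinal.{u}} (hκ : ℵ₀ ≤ κ)
    (hV : #V ≤ κ) (hW : #W ≤ κ) : #(V.tensorRange W) ≤ κ :=
  mk_range_le.trans (TensorProduct.mk_le_of_le hκ hV hW)

end Submodule

/-! ### Subcomodules. -/

namespace RightComod

variable {K : Type u} [Field K]
variable {C : Type u} [AddCommGroup C] [Module K C] [Coalgebra K C]
variable (M : RightComod K C) (V : Submodule K M)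
  (hV : ∀ m ∈ V, M.coact m ∈ V.tensorRange C)

theorem rTensor_subtype_injective (W : Type u) [AddCommGroup W] [Module K W] :
    Function.Injective (V.subtype.rTensor W) :=
  Module.Flat.rTensor_preserves_injective_linearMap _ (Submodule.subtype_injective _)

/-- The coaction on a subcomodule. -/
noncomputable def subCoact : V →ₗ[K] V ⊗[K] C :=
  (LinearEquiv.ofInjective _ (M.rTensor_subtype_injective V C)).symm.toLinearMap ∘ₗ
    (M.coact ∘ₗ V.subtype).codRestrict _ fun m => hV m m.2

theorem rTensor_subtype_comp_subCoact :
    V.subtype.rTensor C ∘ₗ M.subCoact V hV = M.coact ∘ₗ V.subtype := by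
  refine LinearMap.ext fun w => ?_
  exact congrArg Subtype.val (LinearEquiv.apply_symm_apply
    (LinearEquiv.ofInjective _ (M.rTensor_subtype_injective V C))
    ((M.coact ∘ₗ V.subtype).codRestrict _ (fun m => hV m m.2) w))

/-- A subspace stable under the coaction, as a comodule. -/
@[reducible]
noncomputable def sub : RightComod K C :=
  mk' V (M.subCoact V hV)
    (by
      have key := M.rTensor_subtype_comp_subCoact V hV
      have hinj : Function.Injective ((V.subtype.rTensor C).rTensor C) :=
        Module.Flat.rTensor_preserves_injective_linearMap _ (M.rTensor_subtype_injective V C)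
      rw [← LinearMap.cancel_left hinj, ← LinearMap.comp_assoc, cofreeCoact_naturality,
        LinearMap.comp_assoc, key, ← LinearMap.comp_assoc, coassoc', LinearMap.comp_assoc, ← key,
        ← LinearMap.comp_assoc, ← LinearMap.rTensor_comp, ← key, LinearMap.rTensor_comp,
        LinearMap.comp_assoc])
    (by
      have key := M.rTensor_subtype_comp_subCoact V hV
      have h : V.subtype ∘ₗ cofreeCounit K C V = cofreeCounit K C M ∘ₗ V.subtype.rTensor C :=
        (cofreeCounit_map V.subtype (.id K C)).symm
      rw [← LinearMap.cancel_left (Submodule.subtype_injective V), ← LinearMap.comp_assoc, h,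
        LinearMap.comp_assoc, key, ← LinearMap.comp_assoc]
      exact congrArg (· ∘ₗ V.subtype) M.counit)

/-- The inclusion of a subcomodule. -/
noncomputable def subι : M.sub V hV ⟶ M :=
  ⟨V.subtype, (M.rTensor_subtype_comp_subCoact V hV).symm⟩

end RightComod

/-! ### Small saturated subobjects. -/

namespace CisComod

variable {K : Type u} [Field K] {X : Type u} [SmallCategory X] {C : X ⥤ CoalgCat.{u} K}

/-- A family of subspaces `N_x ⊆ M_x` stable under the coactions and the structure maps is
saturated if it contains the elements which the maps `M_x → M_y ⊗ C_x` take to `N_y ⊗ C_x`. -/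
structure IsSaturated (M : CisComod C) (N : ∀ x, Submodule K (M.obj x)) : Prop where
  coact_mem (x : X) : ∀ m ∈ N x, (M.obj x).coact m ∈ (N x).tensorRange (C.obj x)
  map_mem {x y : X} (α : x ⟶ y) : ∀ m ∈ N x, RightComod.corestrictLin (M.map α) m ∈ N y
  mem_of_coindLin_mem {x y : X} (α : x ⟶ y) (m : M.obj x) :
    M.coindLin α m ∈ (N y).tensorRange (C.obj x) → m ∈ N x

namespace IsSaturated

variable {M : CisComod C} {N : ∀ x, Submodule K (M.obj x)} (hN : M.IsSaturated N)

/-- The sub-cis-comodule of a saturated family of subspaces. -/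
noncomputable def sub : CisComod C where
  obj x := (M.obj x).sub (N x) (hN.coact_mem x)
  map {x y} α := RightComod.homOfLin _
    ((RightComod.corestrictLin (M.map α)).restrict (hN.map_mem α)) (by
      have kx := (M.obj x).rTensor_subtype_comp_subCoact (N x) (hN.coact_mem x)
      have ky := (M.obj y).rTensor_subtype_comp_subCoact (N y) (hN.coact_mem y)
      have hr : (N y).subtype ∘ₗ (RightComod.corestrictLin (M.map α)).restrict (hN.map_mem α) =
        RightComod.corestrictLin (M.map α) ∘ₗ (N x).subtype := rfl
      rw [← LinearMap.cancel_left ((M.obj y).rTensor_subtype_injective (N y) (C.obj y))]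
      rw [← LinearMap.comp_assoc, ky, LinearMap.comp_assoc, hr, ← LinearMap.comp_assoc,
        coact_corestrictLin, LinearMap.comp_assoc, ← kx, ← LinearMap.comp_assoc,
        ← LinearMap.comp_assoc, LinearMap.map_comp_rTensor, LinearMap.rTensor_comp_map, hr])
  map_id x := LinearMap.ext fun m => Subtype.ext congr($(M.map_id x) m)
  map_comp α β := LinearMap.ext fun m => Subtype.ext congr($(M.map_comp α β) m)

/-- The inclusion of the sub-cis-comodule of a saturated family of subspaces. -/
noncomputable def ι : hN.sub ⟶ M where
  app x := (M.obj x).subι (N x) (hN.coact_mem x)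
  naturality _ := rfl

/-- An element of `N_y □ C_x` comes from some `m` in `M_x` since `M` is cartesian, and the
saturation condition says exactly that this `m` lies in `N_x`. Injectivity is inherited from `M`. -/
theorem isCartesian_sub (hM : isCartesian C M) : isCartesian C hN.sub := by
  intro x y α
  obtain ⟨h, h'⟩ := (M.isIso_coindMap_iff α).1 (hM α)
  have hinj := (M.obj y).rTensor_subtype_injective (N y) (C.obj x)
  have key (n : N x) : (N y).subtype.rTensor (C.obj x) (hN.sub.coindLin α n) =
      M.coindLin α n := (coindLin_app hN.ι α n).symm
  rw [isIso_coindMap_iff]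
  refine ⟨fun a b hab => ?_, fun w hw => ?_⟩
  · refine Subtype.ext (h ?_)
    exact (key a).symm.trans ((congrArg _ hab).trans (key b))
  · obtain ⟨m, hm⟩ := h' _ (RightComod.rTensor_mem_cotensor (C.map α).toCoalgHom (hN.ι.app y) w hw)
    refine ⟨⟨m, hN.mem_of_coindLin_mem α m ⟨w, hm.symm⟩⟩, hinj ?_⟩
    exact (key _).trans hm

end IsSaturated

/-- A finite set of elements spanning a subspace `V` such that the coaction takes `m` to
`V ⊗ C_x`. -/
noncomputable def coactSupport (M : CisComod C) {x : X} (m : M.obj x) : Finset (M.obj x) :=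
  (Submodule.exists_finset_mem_tensorRange ((M.obj x).coact m)).choose

theorem coact_mem_coactSupport (M : CisComod C) {x : X} (m : M.obj x) :
    (M.obj x).coact m ∈
      (Submodule.span K (M.coactSupport m : Set (M.obj x))).tensorRange (C.obj x) :=
  (Submodule.exists_finset_mem_tensorRange ((M.obj x).coact m)).choose_spec

/-- One step of the construction of the saturation of a family of subspaces. -/
def saturationStep (M : CisComod C) (N : ∀ x, Submodule K (M.obj x)) (x : X) :
    Submodule K (M.obj x) :=
  Submodule.span K ((N x : Set (M.obj x)) ∪ (⋃ m : N x, (M.coactSupport m.1 : Set (M.obj x))) ∪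
    (⋃ p : (Σ z, z ⟶ x), RightComod.corestrictLin (M.map p.2) '' N p.1) ∪
    (⋃ p : (Σ y, x ⟶ y), {m | M.coindLin p.2 m ∈ (N p.1).tensorRange (C.obj x)}))

/-- Iterate `saturationStep` from the spans of the `s x` and take the union. Each step adds at most
`κ` elements, and every saturation condition involves only finitely many elements of the union. -/
theorem exists_isSaturated (M : CisComod C) (hM : isCartesian C M) {κ : Cardinal.{u}}
    (hκ : ℵ₀ ≤ κ) (hK : #K ≤ κ) (hX : #(Σ x y : X, x ⟶ y) ≤ κ) (hC : ∀ x, #(C.obj x) ≤ κ)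
    (s : ∀ x, M.obj x) :
    ∃ N : ∀ x, Submodule K (M.obj x), M.IsSaturated N ∧ (∀ x, s x ∈ N x) ∧ ∀ x, #(N x) ≤ κ := by
  let S (n : ℕ) : ∀ x, Submodule K (M.obj x) :=
    M.saturationStep^[n] fun x => Submodule.span K {s x}
  have hS (n : ℕ) : S (n + 1) = M.saturationStep (S n) := Function.iterate_succ_apply' _ _ _
  have hmono (x : X) : Monotone fun n => S n x := monotone_nat_of_le_succ fun n m hm => by
    rw [hS]
    exact Submodule.subset_span (.inl (.inl (.inl hm)))
  have hcard (n : ℕ) (x : X) : #(S n x) ≤ κ := by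
    induction n generalizing x with
    | zero => exact Submodule.mk_span_le_of_le hκ hK (by simpa using one_le_aleph0.trans hκ)
    | succ n ih =>
      rw [hS]
      refine Submodule.mk_span_le_of_le hκ hK (mk_union_le_of_le hκ (mk_union_le_of_le hκ
        (mk_union_le_of_le hκ (ih x) ?_) ?_) ?_)
      · exact mk_iUnion_le_of_le hκ (ih x) fun m =>
          (mk_lt_aleph0 (α := M.coactSupport m.1)).le.trans hκ
      · refine mk_iUnion_le_of_le hκ (le_trans ?_ hX) fun p => mk_image_le.trans (ih _)
        exact mk_le_of_injective (f := fun p : (Σ z, z ⟶ x) => (⟨p.1, x, p.2⟩ : Σ x y : X, x ⟶ y))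
          fun p q h => by aesop
      · refine mk_iUnion_le_of_le hκ (le_trans ?_ hX) fun p => ?_
        · exact mk_le_of_injective
            (f := fun p : (Σ y, x ⟶ y) => (⟨x, p.1, p.2⟩ : Σ x y : X, x ⟶ y)) fun p q h => by aesop
        · refine le_trans ?_ (Submodule.mk_tensorRange_le_of_le hκ (ih p.1) (hC x))
          -- Cartesianness bounds the preimage of `N_y ⊗ C_x`: an injective map has preimages no
          -- larger than their targets.
          have hinj := ((M.isIso_coindMap_iff p.2).1 (hM p.2)).1
          exact mk_le_of_injective (f := fun m => ⟨M.coindLin p.2 m.1, m.2⟩)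
            fun a b h => Subtype.ext (hinj (congrArg Subtype.val h))
  have hmem (x : X) (m : M.obj x) : m ∈ ⨆ n, S n x ↔ ∃ n, m ∈ S n x :=
    Submodule.mem_iSup_of_directed _ (hmono x).directed_le
  refine ⟨fun x => ⨆ n, S n x, ⟨fun x m hm => ?_, fun {x y} α m hm => ?_, fun {x y} α m hm => ?_⟩,
    fun x => (hmem x _).2 ⟨0, Submodule.subset_span rfl⟩, fun x => ?_⟩
  · obtain ⟨n, hn⟩ := (hmem x m).1 hm
    refine Submodule.tensorRange_mono (Submodule.span_le.2 fun m' hm' => ?_)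
      (M.coact_mem_coactSupport m)
    refine (hmem x m').2 ⟨n + 1, ?_⟩
    rw [hS]
    exact Submodule.subset_span (.inl (.inl (.inr (Set.mem_iUnion.2 ⟨⟨m, hn⟩, hm'⟩))))
  · obtain ⟨n, hn⟩ := (hmem x m).1 hm
    refine (hmem y _).2 ⟨n + 1, ?_⟩
    rw [hS]
    exact Submodule.subset_span (.inl (.inr (Set.mem_iUnion.2 ⟨⟨x, α⟩, m, hn, rfl⟩)))
  · obtain ⟨n, hn⟩ := Submodule.exists_mem_tensorRange_of_mem_iSup (hmono y) hm
    refine (hmem x _).2 ⟨n + 1, ?_⟩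
    rw [hS]
    exact Submodule.subset_span (.inr (Set.mem_iUnion.2 ⟨⟨y, α⟩, hn⟩))
  -- `ULift` moves the index set `ℕ` to universe `u`, where the bound on unions is stated.
  · have h : ((⨆ n, S n x : Submodule K (M.obj x)) : Set (M.obj x)) =
        ⋃ n : ULift.{u} ℕ, (S n.down x : Set (M.obj x)) := by
      ext m
      simp [hmem]
    change #((⨆ n, S n x : Submodule K (M.obj x)) : Set (M.obj x)) ≤ κ
    rw [h]
    exact mk_iUnion_le_of_le hκ (by simpa using hκ) fun n => hcard n.down x

end CisComod

/-! ### A set of representatives of the small objects, and the separator. -/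

namespace CisComod

variable {K : Type u} [Field K] {X : Type u} [SmallCategory X] {C : X ⥤ CoalgCat.{u} K}

variable (C) in
/-- The data of a cis-comodule carried by quotients of a fixed vector space. -/
structure QuotientData (I : Type u) where
  ker (x : X) : Submodule K (I →₀ K)
  coact (x : X) : ((I →₀ K) ⧸ ker x) →ₗ[K] ((I →₀ K) ⧸ ker x) ⊗[K] C.obj x
  map {x y : X} (α : x ⟶ y) : ((I →₀ K) ⧸ ker x) →ₗ[K] ((I →₀ K) ⧸ ker y)

/-- Isomorphisms of a cis-comodule with given data on quotients of a vector space. -/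
structure Presentation {I : Type u} (d : QuotientData C I) (M : CisComod C) where
  equiv (x : X) : M.obj x ≃ₗ[K] ((I →₀ K) ⧸ d.ker x)
  coact_comp (x : X) : d.coact x ∘ₗ (equiv x).toLinearMap =
    (equiv x).toLinearMap.rTensor (C.obj x) ∘ₗ (M.obj x).coact
  map_comp {x y : X} (α : x ⟶ y) : d.map α ∘ₗ (equiv x).toLinearMap =
    (equiv y).toLinearMap ∘ₗ RightComod.corestrictLin (M.map α)

namespace Presentation

variable {I : Type u} {d : QuotientData C I} {M N : CisComod C}

/-- The comparison of two cis-comodules with the same data. -/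
noncomputable def hom (p : Presentation d M) (q : Presentation d N) : M ⟶ N where
  app x := ⟨(q.equiv x).symm.toLinearMap ∘ₗ (p.equiv x).toLinearMap, by
    have hinj : Function.Injective ((q.equiv x).toLinearMap.rTensor (C.obj x)) :=
      Module.Flat.rTensor_preserves_injective_linearMap _ (q.equiv x).injective
    have h : (q.equiv x).toLinearMap ∘ₗ (q.equiv x).symm.toLinearMap ∘ₗ (p.equiv x).toLinearMap =
        (p.equiv x).toLinearMap := LinearMap.ext fun m => (q.equiv x).apply_symm_apply _
    rw [← LinearMap.cancel_left hinj, ← LinearMap.comp_assoc, ← q.coact_comp, LinearMap.comp_assoc,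
      h, ← LinearMap.comp_assoc, ← LinearMap.rTensor_comp, h, p.coact_comp]⟩
  naturality {x y} α := RightComod.hom_ext (LinearMap.ext fun m => (q.equiv y).injective (by
    have h₁ := congr($(p.map_comp α) m)
    have h₂ := congr($(q.map_comp α) ((q.equiv x).symm (p.equiv x m)))
    simp only [LinearMap.comp_apply, LinearEquiv.coe_coe, LinearEquiv.apply_symm_apply] at h₁ h₂
    exact ((q.equiv y).apply_symm_apply _).trans (h₁.symm.trans h₂)))

theorem hom_comp_hom (p : Presentation d M) (q : Presentation d N) :
    p.hom q ≫ q.hom p = 𝟙 M :=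
  Hom.ext (funext fun x => RightComod.hom_ext (LinearMap.ext fun m => by
    change (p.equiv x).symm (q.equiv x ((q.equiv x).symm (p.equiv x m))) = m
    simp))

/-- Two cis-comodules with the same data are isomorphic. -/
@[simps]
noncomputable def iso (p : Presentation d M) (q : Presentation d N) : M ≅ N where
  hom := p.hom q
  inv := q.hom p
  hom_inv_id := hom_comp_hom p q
  inv_hom_id := hom_comp_hom q p

end Presentation

/-- A space with at most `#I` elements is a quotient of `I →₀ K`; the coactions and structure maps
are transported along the quotient isomorphisms. -/
theorem exists_presentation (M : CisComod C) {I : Type u} (hI : ∀ x, #(M.obj x) ≤ #I) :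
    ∃ d : QuotientData C I, Nonempty (Presentation d M) := by
  have hs (x : X) : ∃ f : (I →₀ K) →ₗ[K] M.obj x, Function.Surjective f := by
    obtain ⟨j⟩ := hI x
    refine ⟨Finsupp.linearCombination K (Function.invFun j), ?_⟩
    exact Finsupp.linearCombination_surjective K (Function.invFun_surjective j.injective)
  choose f hf using hs
  let e (x : X) := ((f x).quotKerEquivOfSurjective (hf x)).symm
  refine ⟨⟨fun x => LinearMap.ker (f x),
    fun x => (e x).toLinearMap.rTensor (C.obj x) ∘ₗ (M.obj x).coact ∘ₗ (e x).symm.toLinearMap,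
    fun {x y} α => (e y).toLinearMap ∘ₗ RightComod.corestrictLin (M.map α) ∘ₗ
      (e x).symm.toLinearMap⟩, ⟨e, fun x => ?_, fun {x y} α => ?_⟩⟩
  · ext m
    simp
  · ext m
    simp

theorem hasSeparator_cartesianCisComod [HasCoproducts.{u} (CartesianCisComod C)] :
    HasSeparator (CartesianCisComod C) := by
  -- The disjoint union is infinite and dominates `K`, the arrows of `X` and every `C_x`, so `#I`
  -- can serve as `κ`.
  let I : Type u := ULift.{u} ℕ ⊕ K ⊕ (Σ x y : X, x ⟶ y) ⊕ (Σ x, C.obj x)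
  have hκ : ℵ₀ ≤ #I := by
    simp
  have hK : #K ≤ #I := mk_le_of_injective (f := (Sum.inr ∘ Sum.inl : K → I))
    (Sum.inr_injective.comp Sum.inl_injective)
  have hX : #(Σ x y : X, x ⟶ y) ≤ #I :=
    mk_le_of_injective (f := (Sum.inr ∘ Sum.inr ∘ Sum.inl : (Σ x y : X, x ⟶ y) → I))
      (Sum.inr_injective.comp (Sum.inr_injective.comp Sum.inl_injective))
  have hC (x : X) : #(C.obj x) ≤ #I :=
    mk_le_of_injective (f := (fun c => Sum.inr (Sum.inr (Sum.inr ⟨x, c⟩)) : C.obj x → I))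
      (Sum.inr_injective.comp (Sum.inr_injective.comp
        (Sum.inr_injective.comp sigma_mk_injective)))
  -- Data on quotients of the fixed space `I →₀ K` form a type in universe `u`, so the coproduct
  -- over `T` is small.
  let T := {d : QuotientData C I // ∃ M : CartesianCisComod C, Nonempty (Presentation d M.obj)}
  let G (t : T) : CartesianCisComod C := t.2.choose
  have hG : ObjectProperty.IsSeparating (.ofObj G) := by
    intro M N f g hfg
    refine (isCartesian C).ι.map_injective (Hom.ext (funext fun x =>
      RightComod.hom_ext (LinearMap.ext fun m => ?_)))
    classical
    -- To compare `f` and `g` at `m`, the saturated family has to contain `m` at `x`; elsewhere the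
    -- prescribed element is `0`.
    obtain ⟨S, hS, hm, hcard⟩ := M.obj.exists_isSaturated M.property hκ hK hX hC
      (Function.update 0 x m)
    obtain ⟨d, ⟨p⟩⟩ := hS.sub.exists_presentation hcard
    let P : CartesianCisComod C := ⟨hS.sub, hS.isCartesian_sub M.property⟩
    let t : T := ⟨d, P, ⟨p⟩⟩
    -- The chosen `G t` need not be `P`, but both present the same data `d` and so are isomorphic.
    obtain ⟨q⟩ : Nonempty (Presentation d (G t).obj) := t.2.choose_spec
    have h := hfg (G t) ⟨t⟩ (ObjectProperty.homMk (q.hom p ≫ hS.ι))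
    have h' : q.hom p ≫ hS.ι ≫ f.hom = q.hom p ≫ hS.ι ≫ g.hom := by
      simpa using congr((isCartesian C).ι.map $h)
    have h'' : hS.ι ≫ f.hom = hS.ι ≫ g.hom := (cancel_epi (q.iso p).hom).1 h'
    exact congr((Hom.app $h'' x).toLin ⟨m, by simpa using hm x⟩)
  exact ⟨_, (isSeparator_sigma G).2 hG⟩

end CisComod

/-! ### The Grothendieck property. -/

theorem mainTheorem1 {K : Type u} [Field K] {X : Type u} [PartialOrder X]
    (C : X ⥤ CoalgCat.{u} K)
    (hcoflat : ∀ ⦃x y : X⦄ (α : x ⟶ y), IsLeftCoflat (C.map α).toCoalgHom)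
    (hsemi : ∀ x : X, IsSemiperfectCoalgebra K (C.obj x)) :
    ∃ _ : Abelian (CartesianCisComod C),
      IsGrothendieckAbelian.{u} (CartesianCisComod C) := by
  have := CisComod.isClosedUnderCokernels hcoflat
  -- Closure under kernels, cokernels and finite products makes the subcategory abelian, which
  -- supplies the finite colimits; filtered colimits give the rest.
  have : HasColimitsOfSize.{u, u} (CartesianCisComod C) := has_colimits_of_finite_and_filtered
  have : HasSeparator (CartesianCisComod C) := CisComod.hasSeparator_cartesianCisComod
  exact ⟨inferInstance, { }⟩
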